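/- Let $r$ be a positive integer, let $V=\{v_1<\cdots<v_n\}$ be a linearly ordered set with $n$ elements, and let $2^V$ be the $(n-1)$-dimensional simplex of all subsets of $V$. The $r$th edgewise subdivision $(2^V)^{\langle r\rangle}$ is the simplicial complex on the vertex set $\{u\in\mathbb{N}^n: u_1+\cdots+u_n=r\}$ whose faces are the sets $G$ such that for all $u,u'\in G$ one of the vectors $\iota(u)-\iota(u')$, $\iota(u')-\iota(u)$ lies in $\{0,1\}^n$, where $\iota(u)=(u_1,u_1+u_2,\dots,u_1+\cdots+u_n)$; the carrier of $G$ is the set of all $v_i\in V$ such that $u_i\neq 0$ for some $u\in G$. Write $h(\Delta,x)=\sum_{i=0}^{d} f_{i-1}(\Delta)\,x^i(1-x)^{d-i}$ for the $h$-polynomial of a finite $(d-1)$-dimensional simplicial complex $\Delta$ with $f_{i-1}(\Delta)$ faces having $i$ vertices (the empty face included). The local $h$-polynomial of a subdivision $\Gamma$ of $2^V$ is $\ell_V(\Gamma,x)=\sum_{F\subseteq V}(-1)^{n-|F|}h(\Gamma_F,x)$, where $\Gamma_F$ is the subcomplex of the faces of $\Gamma$ whose carrier is contained in $F$. Let $\mathcal{SW}(n,r)$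 be the set of words $w=(w_0,w_1,\dots,w_n)\in\{0,1,\dots,r-1\}^{n+1}$ with $w_0=w_n=0$ and no two consecutive entries equal. An ascent of $w$ is an index $0\le i\le n-1$ with $w_i<w_{i+1}$; a double ascent (respectively, double descent) is an index $1\le i\le n-1$ with $w_{i-1}<w_i<w_{i+1}$ (respectively, $w_{i-1}>w_i>w_{i+1}$). Write $\mathrm{asc}(w)$ for the number of ascents of $w$. Let $\mathrm{E}_r$ be the linear operator on $\mathbb{R}[x]$ with $\mathrm{E}_r(x^m)=x^{m/r}$ if $r$ divides $m$ and $\mathrm{E}_r(x^m)=0$ otherwise. **Theorem.** We have $$\ell_V\big((2^V)^{\langle r\rangle},x\big)=\mathrm{E}_r\,(x+x^2+\cdots+x^{r-1})^n=\sum_{w\in\mathcal{SW}(n,r)}x^{\mathrm{asc}(w)}=\sum_{i=0}^{\lfloor n/2\rfloor}\xi_{n,r,i}\,x^i(1+x)^{n-2i},$$ where $\xi_{n,r,i}$ is the number of words $w\in\mathcal{SW}(n,r)$ with exactly $i$ ascents which have the following property: for every double ascent $j$ of $w$ there exists a double descent $k>j$ of $w$ such that $w_j=w_k$ and $w_j\le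 w_m$ for all $j<m<k$. Moreover, the numbers $\xi_{n,r,i}$ are the only real coefficients for which the last expansion holds; thus the local $\gamma$-vector of $(2^V)^{\langle r\rangle}$ is $(\xi_{n,r,i})_{0\le i\le\lfloor n/2\rfloor}$ and it is nonnegative. -/

import Mathlib

open Polynomial

namespace LocalH

noncomputable section

/-! Simplicial complexes are Mathlib's `PreAbstractSimplicialComplex`, whose `faces` are the
nonempty faces; the empty face is always understood to be present and is put back by hand
in the face count below. All complexes to which `fNum`, `rank`, `hPoly` are applied are finite. -/

/-- The number `f_{i-1}` of faces with `i` vertices, the empty face included. -/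
def fNum {W : Type*} (K : PreAbstractSimplicialComplex W) (i : ℕ) : ℕ :=
  {G : Finset W | G ∈ insert ∅ K.faces ∧ G.card = i}.ncard

/-- One plus the dimension: the largest number of vertices of a face
(`0` for the complex whose only face is the empty one). -/
def rank {W : Type*} (K : PreAbstractSimplicialComplex W) : ℕ :=
  sSup (Finset.card '' K.faces)

/-- The `h`-polynomial `∑_{i=0}^{d} f_{i-1} x^i (1-x)^{d-i}`, where `d = dim + 1`. -/
def hPoly {W : Type*} (K : PreAbstractSimplicialComplex W) : ℝ[X] :=
  ∑ i ∈ Finset.range (rank K + 1), C (fNum K i : ℝ) * X ^ i * (1 - X) ^ (rank K - i)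

/-- A simplicial complex together with a map sending each face to a subset of `V`, its carrier,
monotonically under inclusion. Subdivisions of the simplex `2^V` are given by such data. -/
structure CarriedComplex (W V : Type*) extends PreAbstractSimplicialComplex W where
  carrier : Finset W → Finset V
  carrier_mono : ∀ {G H : Finset W}, G ⊆ H → carrier G ⊆ carrier H

/-- The restriction `Γ_F`: the subcomplex of the faces whose carrier is contained in `F`. -/
def CarriedComplex.restrict {W V : Type*} (Γ : CarriedComplex W V) (F : Finset V) :
    PreAbstractSimplicialComplex W where
  faces := {G | G ∈ Γ.faces ∧ Γ.carrier G ⊆ F}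
  isRelLowerSet_faces := fun _ hG =>
    ⟨(Γ.isRelLowerSet_faces hG.1).1, fun _ hH hne =>
      ⟨(Γ.isRelLowerSet_faces hG.1).2 hH hne, (Γ.carrier_mono hH).trans hG.2⟩⟩

/-- The local `h`-polynomial `ℓ_V(Γ, x) = ∑_{F ⊆ V} (-1)^{|V| - |F|} h(Γ_F, x)`. -/
def localHPoly {W V : Type*} [Fintype V] (Γ : CarriedComplex W V) : ℝ[X] :=
  ∑ F : Finset V, (-1) ^ (Fintype.card V - F.card) * hPoly (Γ.restrict F)

/-- `ξ` is the local `γ`-vector of `Γ`: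
`ℓ_V(Γ, x) = ∑_{i=0}^{⌊d/2⌋} ξ_i x^i (1+x)^{d-2i}`, where `d = |V|`. -/
def IsLocalGamma {W V : Type*} [Fintype V] (Γ : CarriedComplex W V) (ξ : ℕ → ℝ) : Prop :=
  localHPoly Γ = ∑ i ∈ Finset.range (Fintype.card V / 2 + 1),
    C (ξ i) * X ^ i * (1 + X) ^ (Fintype.card V - 2 * i)

/-! ### The edgewise subdivision -/

/-- The support of a vector; it is the vertex set of the smallest face of the simplex on `V`
which contains the point with barycentric coordinates proportional to `u`. -/
def supp {V : Type*} [Fintype V] (u : V → ℕ) : Finset V :=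
  Finset.univ.filter fun i => u i ≠ 0

/-- The partial sums `(u_1, u_1 + u_2, …, u_1 + ⋯ + u_n)` along the linear order of `V`. -/
def partialSums {V : Type*} [Fintype V] [LinearOrder V] (u : V → ℕ) (i : V) : ℕ :=
  ∑ j ∈ Finset.univ.filter (fun j => j ≤ i), u j

/-- The vector of partial sums of `v` minus that of `u` has all its entries in `{0, 1}`. -/
def Step {V : Type*} [Fintype V] [LinearOrder V] (u v : V → ℕ) : Prop :=
  ∀ i, partialSums v i = partialSums u i ∨ partialSums v i = partialSums u i + 1

/-- The `r`-th edgewise subdivision of a simplicial complex `Δ` on a linearly ordered vertex set.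
Its vertices are the vectors `u ∈ ℕ^V` with coordinate sum `r` (standing for the points with
barycentric coordinates `u / r`) and a set `G` of such vectors is a face if the union of the
supports is a face of `Δ` and, for any `u, v ∈ G`, the partial sums of `u` and `v` differ by
a `0/1` vector. The carrier of a face is the union of the supports of its vertices. -/
def edgewise {V : Type*} [Fintype V] [LinearOrder V] (Δ : PreAbstractSimplicialComplex V)
    (r : ℕ) : CarriedComplex (V → ℕ) V where
  faces := {G | (∀ u ∈ G, ∑ i, u i = r) ∧ G.biUnion supp ∈ Δ.faces ∧
    ∀ u ∈ G, ∀ v ∈ G, Step u v ∨ Step v u}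
  isRelLowerSet_faces := by
    rintro G ⟨hs, hΔ, hst⟩
    have hne := (Δ.isRelLowerSet_faces hΔ).1
    refine ⟨?_, fun H hH hH0 => ⟨fun u hu => hs u (hH hu), ?_,
      fun u hu v hv => hst u (hH hu) v (hH hv)⟩⟩
    · obtain ⟨i, hi⟩ := hne
      obtain ⟨u, hu, -⟩ := Finset.mem_biUnion.1 hi
      exact ⟨u, hu⟩
    · refine (Δ.isRelLowerSet_faces hΔ).2 (Finset.biUnion_subset_biUnion_of_subset_left _ hH) ?_
      obtain ⟨u, hu⟩ := hH0
      have hr : 0 < r := by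
        obtain ⟨i, hi⟩ := hne
        obtain ⟨v, hv, hiv⟩ := Finset.mem_biUnion.1 hi
        rw [← hs v hv]
        exact Finset.sum_pos' (fun _ _ => Nat.zero_le _)
          ⟨i, Finset.mem_univ i, Nat.pos_of_ne_zero (Finset.mem_filter.1 hiv).2⟩
      have hpos : ∑ i, u i ≠ 0 := by rw [hs u (hH hu)]; exact hr.ne'
      obtain ⟨i, -, hi⟩ := Finset.exists_ne_zero_of_sum_ne_zero hpos
      exact ⟨i, Finset.mem_biUnion.2 ⟨u, hu, Finset.mem_filter.2 ⟨Finset.mem_univ i, hi⟩⟩⟩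
  carrier := fun G => G.biUnion supp
  carrier_mono := fun h => Finset.biUnion_subset_biUnion_of_subset_left _ h

/-- The abstract simplex `2^V`. -/
def simplex (V : Type*) : PreAbstractSimplicialComplex V where
  faces := {F | F.Nonempty}
  isRelLowerSet_faces := fun _ hF => ⟨hF, fun _ _ h => h⟩

/-- The linear operator `E_r` on `ℝ[x]` with `E_r(x^m) = x^{m/r}` if `r ∣ m` and
`E_r(x^m) = 0` otherwise. -/
def E (r : ℕ) : ℝ[X] →ₗ[ℝ] ℝ[X] :=
  Polynomial.lsum fun m => if r ∣ m then Polynomial.monomial (m / r) else 0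

/-! ### Smirnov words -/

/-- The words `(w_0, …, w_n)` over `{0, …, r-1}` with `w_0 = w_n = 0` and no two
consecutive entries equal. -/
def smirnovWords (n r : ℕ) : Finset (Fin (n + 1) → Fin r) :=
  Finset.univ.filter fun w =>
    (w 0 : ℕ) = 0 ∧ (w (Fin.last n) : ℕ) = 0 ∧ ∀ i : Fin n, w i.castSucc ≠ w i.succ

/-- The number of ascents: indices `0 ≤ i ≤ n - 1` with `w_i < w_{i+1}`. -/
def asc {n r : ℕ} (w : Fin (n + 1) → Fin r) : ℕ :=
  (Finset.univ.filter fun i : Fin n => w i.castSucc < w i.succ).card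

/-- `j` is a double ascent: `1 ≤ j ≤ n - 1` and `w_{j-1} < w_j < w_{j+1}`. -/
def IsDoubleAscent {n r : ℕ} (w : Fin (n + 1) → Fin r) (j : Fin (n + 1)) : Prop :=
  ∃ i k : Fin (n + 1), (i : ℕ) + 1 = j ∧ (j : ℕ) + 1 = k ∧ w i < w j ∧ w j < w k

/-- `j` is a double descent: `1 ≤ j ≤ n - 1` and `w_{j-1} > w_j > w_{j+1}`. -/
def IsDoubleDescent {n r : ℕ} (w : Fin (n + 1) → Fin r) (j : Fin (n + 1)) : Prop :=
  ∃ i k : Fin (n + 1), (i : ℕ) + 1 = j ∧ (j : ℕ) + 1 = k ∧ w j < w i ∧ w k < w j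

/-- Every double ascent `j` is matched by a double descent `k > j` with `w_j = w_k` and
`w_j ≤ w_m` for all `j < m < k`. -/
def DoubleAscentsMatched {n r : ℕ} (w : Fin (n + 1) → Fin r) : Prop :=
  ∀ j, IsDoubleAscent w j → ∃ k, IsDoubleDescent w k ∧ j < k ∧ w j = w k ∧
    ∀ m, j < m → m < k → w j ≤ w m

open Classical in
/-- The number `ξ_{n,r,i}` of Smirnov words with exactly `i` ascents whose double ascents
are all matched. -/
def xi (n r i : ℕ) : ℕ :=
  ((smirnovWords n r).filter fun w => asc w = i ∧ DoubleAscentsMatched w).card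

end

end LocalH

/-! The proof has three independent parts. Geometry. Adding up the vertices of a multiset supported
on a face is a bijection from multisets of size `k` in `Γ_F` onto vectors in `ℕ^F` with sum `rk`
(`card_weighted_faces`). The smallest vertex is recovered from the sum `u` by dividing the partial
sums of `u` by `k` and rounding down. Conversely `⌊(P + j)/k⌋`, `j < k`, are the partial sums of
vertices adding up to `u`, by Hermite's identity. Hence `∑_G (x/(1-x))^|G|` is the `r`-section of
`1/(1-x)^|F|`, so `h(Γ_F) = E_r (1+⋯+x^(r-1))^|F|`, and the alternating sum over `F` is a binomial
expansion. Residues. Reading a word as a walk modulo `r` that goes down by `1, …, r-1` at each step,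
an ascent is exactly a wrap-around. The total decrease of a closed walk is therefore `r` times its
ascents, which gives the sum over Smirnov words. Gamma expansion. Give each step the weight `b` and
each ascent the weight `u`, and cut words at the occurrences of their smallest letter. The resulting
recursion (`genFun_closedWt_eq`) involves only `u b²` and the combined weight of unmatched double
ascents and unmatched double descents. All words with `(u, b) = (x, 1)` give `x` and `x + 1`;
matched words with `(x/(1+x)², 1+x)` give `x` and `0 + (1+x)`. Thus both families have the same
generating function. -/

namespace LocalH

/-! ### Generating functions of sums over words -/

section WordSums

variable {R : Type*} [CommRing R]

/-- The sum of `φ` over all words of length `n` with letters `< r`. -/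
def wordSum (r : ℕ) : (List ℕ → R) → ℕ → R
  | φ, 0 => φ []
  | φ, n + 1 => ∑ d ∈ Finset.range r, wordSum r (fun s => φ (d :: s)) n

/-- The generating function of the sums of `φ` over words of given length. -/
noncomputable def genFun (r : ℕ) (φ : List ℕ → R) : PowerSeries R :=
  PowerSeries.mk (wordSum r φ)

/-- The sum of `φ A * ψ B` over all ways to write a word as `A ++ a :: B`. -/
def midConv (a : ℕ) : (List ℕ → R) → (List ℕ → R) → List ℕ → R
  | _, _, [] => 0
  | φ, ψ, d :: s =>
    (if d = a then φ [] * ψ s else 0) + midConv a (fun t => φ (d :: t)) ψ s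

theorem wordSum_add (r : ℕ) (n : ℕ) : ∀ φ ψ : List ℕ → R,
    wordSum r (fun s => φ s + ψ s) n = wordSum r φ n + wordSum r ψ n := by
  induction n with
  | zero => intro φ ψ; rfl
  | succ n ih => intro φ ψ; simp only [wordSum, ih, Finset.sum_add_distrib]

theorem wordSum_const_mul (r : ℕ) (c : R) (n : ℕ) : ∀ φ : List ℕ → R,
    wordSum r (fun s => c * φ s) n = c * wordSum r φ n := by
  induction n with
  | zero => intro φ; rfl
  | succ n ih => intro φ; simp only [wordSum, ih, Finset.mul_sum]

theorem wordSum_zero (r n : ℕ) : wordSum r (fun _ => (0 : R)) n = 0 := by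
  simpa using wordSum_const_mul r (0 : R) n (fun _ => 0)

theorem wordSum_congr {r : ℕ} (n : ℕ) : ∀ {φ ψ : List ℕ → R},
    (∀ s, s.length = n → (∀ m ∈ s, m < r) → φ s = ψ s) → wordSum r φ n = wordSum r ψ n := by
  induction n with
  | zero => intro φ ψ h; exact h [] rfl (by simp)
  | succ n ih =>
    intro φ ψ h
    refine Finset.sum_congr rfl fun d hd => ih fun s hs hs' => h _ (by simp [hs]) ?_
    simpa using ⟨Finset.mem_range.1 hd, hs'⟩

theorem genFun_add (r : ℕ) (φ ψ : List ℕ → R) :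
    genFun r (fun s => φ s + ψ s) = genFun r φ + genFun r ψ := by
  ext n; simp [genFun, wordSum_add]

theorem genFun_const_mul (r : ℕ) (c : R) (φ : List ℕ → R) :
    genFun r (fun s => c * φ s) = PowerSeries.C c * genFun r φ := by
  ext n; simp [genFun, wordSum_const_mul]

theorem genFun_nil (r : ℕ) : genFun r (fun s => if s = [] then (1 : R) else 0) = 1 := by
  ext n
  cases n with
  | zero => simp [genFun, wordSum]
  | succ n => simp [genFun, wordSum, wordSum_zero, PowerSeries.coeff_one]

theorem genFun_eq (r : ℕ) (φ : List ℕ → R) :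
    genFun r φ = PowerSeries.C (φ []) +
      PowerSeries.X * ∑ d ∈ Finset.range r, genFun r (fun s => φ (d :: s)) := by
  ext n
  cases n with
  | zero => simp [genFun, wordSum]
  | succ n => simp [genFun, wordSum, PowerSeries.coeff_succ_X_mul]

/-- Concatenation becomes a product, and the factor `X` records the separating letter `a`. In the
induction the first letter is either that separator or is absorbed into `φ`. -/
theorem genFun_midConv {r a : ℕ} (ha : a < r) (φ ψ : List ℕ → R) :
    genFun r (midConv a φ ψ) = PowerSeries.X * (genFun r φ * genFun r ψ) := by
  ext n
  induction n generalizing φ with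
  | zero => simp [genFun, wordSum, midConv]
  | succ n ih =>
    have h1 : PowerSeries.coeff (n + 1) (genFun r (midConv a φ ψ)) =
        φ [] * wordSum r ψ n + ∑ d ∈ Finset.range r,
          PowerSeries.coeff n (genFun r (midConv a (fun t => φ (d :: t)) ψ)) := by
      simp only [genFun, PowerSeries.coeff_mk, wordSum, midConv, wordSum_add,
        Finset.sum_add_distrib]
      congr 1
      rw [Finset.sum_eq_single a]
      · simp [wordSum_const_mul]
      · intro d _ hd; simp [hd, wordSum_zero]
      · intro h; exact absurd (Finset.mem_range.2 ha) h
    rw [h1, PowerSeries.coeff_succ_X_mul, genFun_eq r φ, add_mul, map_add,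
      PowerSeries.coeff_C_mul, mul_assoc, Finset.sum_mul, Finset.mul_sum, map_sum]
    congr 1
    · simp [genFun]
    · exact Finset.sum_congr rfl fun d _ => ih _

theorem midConv_zero_left (a : ℕ) (ψ : List ℕ → R) (s : List ℕ) :
    midConv a (fun _ => 0) ψ s = 0 := by
  induction s with
  | nil => rfl
  | cons d s ih => simp [midConv, ih]

theorem midConv_of_notMem {a : ℕ} {s : List ℕ} (h : a ∉ s) (φ ψ : List ℕ → R) :
    midConv a φ ψ s = 0 := by
  induction s generalizing φ with
  | nil => rfl
  | cons d s ih =>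
    rw [List.mem_cons, not_or] at h
    simp [midConv, ih h.2, Ne.symm h.1]

/-- Since `φ` kills words containing `a`, only the cut at the first `a` survives: the decomposition
is unique. -/
theorem midConv_append {a : ℕ} {A : List ℕ} (h : a ∉ A) (B : List ℕ) (φ ψ : List ℕ → R)
    (hφ : ∀ s, a ∈ s → φ s = 0) : midConv a φ ψ (A ++ a :: B) = φ A * ψ B := by
  induction A generalizing φ with
  | nil =>
    have : (fun t => φ (a :: t)) = fun _ => 0 := funext fun t => hφ _ (by simp)
    simp [midConv, this, midConv_zero_left]
  | cons d s ih =>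
    rw [List.mem_cons, not_or] at h
    rw [List.cons_append, midConv, if_neg (Ne.symm h.1), zero_add, ih h.2]
    intro t ht
    exact hφ _ (by simp [ht])

end WordSums

/-! ### Ascents and matching on lists -/

section Lists

/-- The number of ascents of a word. -/
def ascList : List ℕ → ℕ
  | a :: b :: s => (if a < b then 1 else 0) + ascList (b :: s)
  | _ => 0

/-- Among the entries of a word up to its first entry `< c` or its end, all entries being `≥ c`,
there is an entry `c` which is followed by a smaller entry or is the last one. -/
def Closes (c : ℕ) : List ℕ → Prop
  | [] => False
  | d :: s => (d = c ∧ ∀ e ∈ s.head?, e < c) ∨ (c ≤ d ∧ Closes c s)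

/-- Every double ascent of the word is matched by a later double descent; `up` tells whether the
first entry is to be regarded as preceded by a smaller one, the last entry is regarded as followed
by a smaller one. -/
def Matched : Bool → List ℕ → Prop
  | up, c :: d :: s =>
    (up = true → c < d → Closes c (d :: s)) ∧ Matched (decide (c < d)) (d :: s)
  | _, _ => True

theorem ascList_append_cons {a : ℕ} {A : List ℕ} (hA : ∀ m ∈ A, a < m) (B : List ℕ) :
    ascList (A ++ a :: B) = ascList A + ascList (a :: B) := by
  induction A with
  | nil => simp [ascList]
  | cons c A ih =>
    cases A with
    | nil => simp [ascList, (hA c (by simp)).le]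
    | cons d A =>
      have := ih (fun m hm => hA m (List.mem_cons_of_mem _ hm))
      simp only [List.cons_append, ascList] at this ⊢
      omega

theorem ascList_cons_of_lt {a : ℕ} {A : List ℕ} (hA : ∀ m ∈ A, a < m) (h : A ≠ []) :
    ascList (a :: A) = 1 + ascList A := by
  cases A with
  | nil => exact absurd rfl h
  | cons c A => simp [ascList, hA c (by simp)]

/-- The search for a closing `c` stops at the smaller entry `b`, which acts just like the end of the
word. -/
theorem closes_append_cons {b c : ℕ} (h : b < c) (T Q : List ℕ) :
    Closes c (T ++ b :: Q) ↔ Closes c T := by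
  induction T with
  | nil => simp [Closes]; omega
  | cons d T ih =>
    simp only [List.cons_append, Closes, ih]
    cases T <;> simp [h]

/-- No entry is followed by one below `a`, so only the last entry can close. -/
theorem closes_iff_getLastD {a : ℕ} {B : List ℕ} (hB : ∀ m ∈ B, a ≤ m) :
    Closes a B ↔ B ≠ [] ∧ B.getLastD a = a := by
  induction B with
  | nil => simp [Closes]
  | cons d T ih =>
    have h1 := ih (fun m hm => hB m (List.mem_cons_of_mem _ hm))
    have h2 := hB d (by simp)
    rw [Closes, h1]
    cases T with
    | nil => simp
    | cons e T =>
      have := hB e (by simp)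
      simp; omega

/-- A smaller entry `b` separates the matching conditions: no double ascent in `A` looks past it,
and `b` is entered by a descent, hence `false`. -/
theorem matched_append_cons {b : ℕ} {A : List ℕ} (hA : ∀ m ∈ A, b < m) (h : A ≠ [])
    (up : Bool) (Q : List ℕ) :
    Matched up (A ++ b :: Q) ↔ Matched up A ∧ Matched false (b :: Q) := by
  induction A generalizing up with
  | nil => exact absurd rfl h
  | cons c A ih =>
    have hc := hA c (by simp)
    cases A with
    | nil => simp [Matched, hc.not_gt]
    | cons d A =>
      have := ih (fun m hm => hA m (List.mem_cons_of_mem _ hm)) (by simp) (decide (c < d))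
      simp only [List.cons_append] at this
      simp only [List.cons_append, Matched, this]
      rw [← List.cons_append, closes_append_cons hc, and_assoc]

theorem matched_cons_of_lt {a : ℕ} {A : List ℕ} (hA : ∀ m ∈ A, a < m) (up : Bool) :
    Matched up (a :: A) ↔ (up = true → A ≠ [] → Closes a A) ∧ Matched true A := by
  cases A with
  | nil => simp [Matched]
  | cons d A => simp [Matched, hA d (by simp)]

/-- If `B` is nonempty, the initial `a`, preceded by something smaller, is a double ascent, and by
minimality of `a` only a final `a` can match it. If `B` is empty, `a` is a peak. -/
theorem matched_true_cons {a : ℕ} {B : List ℕ} (hc : (a :: B).IsChain (· ≠ ·))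
    (hB : ∀ m ∈ B, a ≤ m) :
    Matched true (a :: B) ↔ B.getLastD a = a ∧ Matched false (a :: B) := by
  cases B with
  | nil => simp [Matched]
  | cons d B =>
    have h1 : a ≠ d := (List.isChain_cons_cons.1 hc).1
    have h2 := hB d (by simp)
    have h3 : a < d := by omega
    have h4 := closes_iff_getLastD hB
    simp only [Matched, h4, h3]
    simp

theorem getLastD_append_cons (a d : ℕ) (A B : List ℕ) :
    (A ++ a :: B).getLastD d = B.getLastD a := by
  induction A generalizing d with
  | nil => rw [List.nil_append, List.getLastD_cons]
  | cons c A ih => rw [List.cons_append, List.getLastD_cons, ih]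

end Lists

/-! ### Decomposition of words at their smallest letter -/

section Grammar

/-- Nonempty words without equal neighbours, with all entries `≥ a`. -/
def IsSeg (a : ℕ) (s : List ℕ) : Prop := s ≠ [] ∧ s.IsChain (· ≠ ·) ∧ ∀ m ∈ s, a ≤ m

/-- Words without equal neighbours and with all entries `≥ a` which may follow an entry `a`. -/
def IsTail (a : ℕ) (s : List ℕ) : Prop := (a :: s).IsChain (· ≠ ·) ∧ ∀ m ∈ s, a ≤ m

theorem isSeg_succ_iff {a : ℕ} {s : List ℕ} : IsSeg (a + 1) s ↔ IsSeg a s ∧ a ∉ s := by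
  unfold IsSeg
  constructor
  · rintro ⟨h1, h2, h3⟩
    exact ⟨⟨h1, h2, fun m hm => (h3 m hm).trans' (by omega)⟩, fun h => by
      have := h3 a h; omega⟩
  · rintro ⟨⟨h1, h2, h3⟩, h4⟩
    refine ⟨h1, h2, fun m hm => ?_⟩
    have : m ≠ a := fun h => h4 (h ▸ hm)
    have := h3 m hm
    omega

theorem isTail_append_cons {a : ℕ} {A B : List ℕ} (h : a ∉ A) :
    IsTail a (A ++ a :: B) ↔ IsSeg (a + 1) A ∧ IsTail a B := by
  rw [isSeg_succ_iff]
  unfold IsSeg IsTail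
  cases A with
  | nil => simp
  | cons c A =>
    have hac : a ≠ c := fun e => h (by simp [e])
    have hlast : ∀ x ∈ (c :: A).getLast?, ∀ y ∈ (a :: B).head?, x ≠ y := by
      intro x hx y hy
      simp only [List.head?_cons, Option.mem_def, Option.some.injEq] at hy
      subst hy
      intro e; subst e
      exact h (List.mem_of_getLast? hx)
    rw [List.cons_append, List.isChain_cons_cons, ← List.cons_append, List.isChain_append]
    simp only [List.mem_append, List.mem_cons]
    constructor
    · rintro ⟨⟨-, h1, h2, -⟩, h3⟩
      exact ⟨⟨⟨by simp, h1, fun m hm => h3 m (Or.inl (by simpa using hm))⟩, by simpa using h⟩, h2,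
        fun m hm => h3 m (by simp [hm])⟩
    · rintro ⟨⟨⟨-, h1, h2⟩, -⟩, h3, h4⟩
      refine ⟨⟨hac, h1, h3, hlast⟩, ?_⟩
      rintro m (hm | rfl | hm)
      · exact h2 m hm
      · exact le_rfl
      · exact h4 m hm

theorem isSeg_append_cons {a : ℕ} {A B : List ℕ} (h : a ∉ A) (hA : A ≠ []) :
    IsSeg a (A ++ a :: B) ↔ IsSeg (a + 1) A ∧ IsTail a B := by
  rw [← isTail_append_cons h]
  unfold IsSeg IsTail
  cases A with
  | nil => exact absurd rfl hA
  | cons c A =>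
    have hac : a ≠ c := fun e => h (by simp [e])
    simp only [List.cons_append, List.isChain_cons_cons]
    simp [hac]

theorem isSeg_cons_self {a : ℕ} {B : List ℕ} : IsSeg a (a :: B) ↔ IsTail a B := by
  simp [IsSeg, IsTail]

theorem IsSeg.lt {a : ℕ} {s : List ℕ} (h : IsSeg (a + 1) s) : ∀ m ∈ s, a < m := h.2.2

theorem isTail_of_notMem {a : ℕ} {s : List ℕ} (h : a ∉ s) (hs : s ≠ []) :
    IsTail a s ↔ IsSeg (a + 1) s := by
  rw [isSeg_succ_iff]
  unfold IsSeg IsTail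
  cases s with
  | nil => exact absurd rfl hs
  | cons c A =>
    have hac : a ≠ c := fun e => h (by simp [e])
    simp [List.isChain_cons_cons, hac] at h ⊢
    tauto

variable {R : Type*} [CommRing R] (flag : Prop) (u b : R)

open Classical in
/-- Weight of a segment between two smaller entries. -/
noncomputable def segWt (a : ℕ) (s : List ℕ) : R :=
  if IsSeg a s ∧ (flag → Matched true s) then u ^ (1 + ascList s) * b ^ (s.length + 1) else 0

open Classical in
/-- Weight of the word following an entry `a`, with last entry `a`. -/
noncomputable def closedWt (a : ℕ) (s : List ℕ) : R :=
  if IsTail a s ∧ s.getLastD a = a ∧ (flag → Matched false (a :: s)) then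
    u ^ ascList (a :: s) * b ^ s.length else 0

open Classical in
/-- Weight of the word following an entry `a`, with last entry greater than `a`. -/
noncomputable def openWt (a : ℕ) (s : List ℕ) : R :=
  if IsTail a s ∧ s.getLastD a ≠ a ∧ (flag → Matched false (a :: s)) then
    u ^ ascList (a :: s) * b ^ (s.length + 1) else 0

theorem segWt_succ_of_mem {a : ℕ} (s : List ℕ) (h : a ∈ s) : segWt flag u b (a + 1) s = 0 := by
  rw [segWt, if_neg]
  rw [isSeg_succ_iff]; tauto

/-- The segment `A` lies between two smaller entries `a`. The step up into it is the extra ascent,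
and it makes the first entry of `A` a potential double ascent. -/
theorem tail_facts {a : ℕ} {A : List ℕ} (hA : IsSeg (a + 1) A) (B : List ℕ) :
    (Matched false (a :: (A ++ a :: B)) ↔ Matched true A ∧ Matched false (a :: B)) ∧
    ascList (a :: (A ++ a :: B)) = (1 + ascList A) + ascList (a :: B) := by
  obtain ⟨c, A', rfl⟩ := List.exists_cons_of_ne_nil hA.1
  have hc : a < c := hA.lt c (by simp)
  constructor
  · rw [← matched_append_cons hA.lt hA.1, List.cons_append, Matched]
    simp [hc]
  · rw [add_assoc, ← ascList_append_cons hA.lt, List.cons_append, ascList, if_pos hc]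

theorem ite_zero_congr {P Q : Prop} {_ : Decidable P} {_ : Decidable Q} {x y : R} (h : P ↔ Q)
    (hxy : x = y) : ite P x 0 = ite Q y 0 := if_congr h hxy rfl

/-- A closed tail is empty, or it rises to a segment above `a`, returns to `a` and goes on as a
closed tail. The exponents of `b` count steps, a segment owning the steps into and out of it, so the
weights multiply. -/
theorem closedWt_eq (a : ℕ) (s : List ℕ) :
    closedWt flag u b a s = (if s = [] then 1 else 0) +
      midConv a (segWt flag u b (a + 1)) (closedWt flag u b a) s := by
  classical
  by_cases has : a ∈ s
  · obtain ⟨A, B, rfl, hA⟩ := List.eq_append_cons_of_mem has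
    rw [midConv_append hA _ _ _ (segWt_succ_of_mem flag u b), if_neg (by simp), zero_add]
    unfold closedWt segWt
    rw [ite_zero_mul_ite_zero]
    by_cases hs : IsSeg (a + 1) A
    · obtain ⟨h1, h2⟩ := tail_facts hs B
      rw [h1, h2, isTail_append_cons hA, getLastD_append_cons]
      refine ite_zero_congr (by tauto) ?_
      simp only [List.length_append, List.length_cons]; ring
    · rw [if_neg, if_neg]
      · tauto
      · rw [isTail_append_cons hA]; tauto
  · rw [midConv_of_notMem has, add_zero]
    unfold closedWt
    by_cases hs : s = []
    · subst hs
      simp [IsTail, Matched, ascList]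
    · rw [if_neg, if_neg hs]
      rintro ⟨-, h, -⟩
      apply has
      rw [List.getLastD_eq_getLast?, List.getLast?_eq_getLast_of_ne_nil hs] at h
      simp only [Option.getD_some] at h
      exact h ▸ List.getLast_mem hs

/-- An open tail that never returns to `a` is a single segment above `a`; otherwise cut at the first
return. -/
theorem openWt_eq (a : ℕ) (s : List ℕ) :
    openWt flag u b a s = segWt flag u b (a + 1) s +
      midConv a (segWt flag u b (a + 1)) (openWt flag u b a) s := by
  classical
  by_cases has : a ∈ s
  · obtain ⟨A, B, rfl, hA⟩ := List.eq_append_cons_of_mem has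
    rw [midConv_append hA _ _ _ (segWt_succ_of_mem flag u b), segWt_succ_of_mem _ _ _ _ has,
      zero_add]
    unfold openWt segWt
    rw [ite_zero_mul_ite_zero]
    by_cases hs : IsSeg (a + 1) A
    · obtain ⟨h1, h2⟩ := tail_facts hs B
      rw [h1, h2, isTail_append_cons hA, getLastD_append_cons]
      refine ite_zero_congr (by tauto) ?_
      simp only [List.length_append, List.length_cons]; ring
    · rw [if_neg, if_neg]
      · tauto
      · rw [isTail_append_cons hA]; tauto
  · rw [midConv_of_notMem has, add_zero]
    unfold openWt segWt
    by_cases hs : s = []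
    · subst hs
      simp [IsSeg]
    · have hlast : s.getLastD a ≠ a := by
        intro h
        rw [List.getLastD_eq_getLast?, List.getLast?_eq_getLast_of_ne_nil hs] at h
        simp only [Option.getD_some] at h
        exact has (h ▸ List.getLast_mem hs)
      rw [isTail_of_notMem has hs]
      by_cases hseg : IsSeg (a + 1) s
      · rw [matched_cons_of_lt hseg.lt, ascList_cons_of_lt hseg.lt hs]
        exact ite_zero_congr (by simp [hlast, hseg, -List.getLastD_eq_getLast?]) rfl
      · simp [hseg]

-- Cut at the first `a`. With `a` at both ends the boundary contributes `u b²`. Starting at `a` and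
-- ending above it makes the initial `a` an unmatched double ascent: weight `u b`, forbidden under
-- `flag`. Starting above and ending at `a` makes the final `a` an unmatched double descent, weight
-- `b`. Starting and ending above costs nothing extra.
open Classical in
theorem segWt_eq (a : ℕ) (s : List ℕ) :
    segWt flag u b a s = segWt flag u b (a + 1) s +
      midConv a (fun t => if t = [] then 1 else 0) (fun t => (u * b ^ 2) * closedWt flag u b a t +
        (if flag then 0 else u * b) * openWt flag u b a t) s +
      midConv a (segWt flag u b (a + 1))
        (fun t => b * closedWt flag u b a t + openWt flag u b a t) s := by
  by_cases has : a ∈ s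
  · obtain ⟨A, B, rfl, hA⟩ := List.eq_append_cons_of_mem has
    rw [midConv_append hA _ _ _ (segWt_succ_of_mem flag u b), segWt_succ_of_mem _ _ _ _ has,
      midConv_append hA _ _ _ (fun t ht => if_neg (List.ne_nil_of_mem ht)), zero_add]
    by_cases hA0 : A = []
    · subst hA0
      have h0 : segWt flag u b (a + 1) [] = 0 := by simp [segWt, IsSeg]
      rw [h0, zero_mul, add_zero, if_pos rfl, one_mul, List.nil_append]
      unfold segWt closedWt openWt
      rw [isSeg_cons_self]
      by_cases hB : IsTail a B
      · rw [matched_true_cons hB.1 hB.2]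
        by_cases hl : B.getLastD a = a <;> by_cases hf : flag <;>
          by_cases hm : Matched false (a :: B) <;> simp [hB, hl, hf, hm, -List.getLastD_eq_getLast?] <;> ring
      · simp [hB]
    · rw [if_neg hA0, zero_mul, zero_add]
      unfold segWt closedWt openWt
      by_cases hs : IsSeg (a + 1) A
      · rw [isSeg_append_cons hA hA0, matched_append_cons hs.lt hA0, ascList_append_cons hs.lt]
        by_cases hB : IsTail a B
        · by_cases hl : B.getLastD a = a <;> by_cases hf : flag <;>
            by_cases hm : Matched false (a :: B) <;> by_cases hm' : Matched true A <;>
            simp [hs, hB, hl, hf, hm, hm', -List.getLastD_eq_getLast?] <;> ring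
        · simp [hB]
      · rw [if_neg, if_neg]
        · simp
        · tauto
        · rw [isSeg_append_cons hA hA0]; tauto
  · rw [midConv_of_notMem has, midConv_of_notMem has, add_zero, add_zero]
    unfold segWt
    rw [isSeg_succ_iff]
    simp [has]

open Classical in
/-- The generating function of closed tails depends on the weights only through `u * b ^ 2` and
the joint weight of the two ways in which a double ascent and a double descent may fail to match. -/
theorem genFun_closedWt_eq {flag' : Prop} {u' b' : R} (h1 : u * b ^ 2 = u' * b' ^ 2)
    (h2 : (if flag then 0 else u * b) + b = (if flag' then 0 else u' * b') + b')
    {r : ℕ} (a : ℕ) (ha : a < r) :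
    genFun r (closedWt flag u b a) = genFun r (closedWt flag' u' b' a) := by
  -- Closed tails form a geometric series in the segments above `a`.
  have hE : ∀ (flag : Prop) (u b : R) (a : ℕ), a < r → genFun r (closedWt flag u b a) *
      (1 - PowerSeries.X * genFun r (segWt flag u b (a + 1))) = 1 := by
    intro flag u b a ha
    have := congrArg (genFun r) (funext (closedWt_eq flag u b a))
    rw [genFun_add, genFun_nil, genFun_midConv ha] at this
    linear_combination this
  have hN : ∀ (flag : Prop) (u b : R) (a : ℕ), a < r → genFun r (openWt flag u b a) =
      genFun r (closedWt flag u b a) * genFun r (segWt flag u b (a + 1)) := by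
    intro flag u b a ha
    have := congrArg (genFun r) (funext (openWt_eq flag u b a))
    rw [genFun_add, genFun_midConv ha] at this
    linear_combination genFun r (closedWt flag u b a) * this - genFun r (openWt flag u b a) *
      hE flag u b a ha
  -- After open tails are eliminated by `hN`, the weights enter only through the two combinations
  -- that `h1` and `h2` equate.
  have hG : ∀ (flag : Prop) (u b : R) (a : ℕ), a < r → genFun r (segWt flag u b a) =
      genFun r (segWt flag u b (a + 1)) + PowerSeries.X * (genFun r (closedWt flag u b a) *
        (PowerSeries.C (u * b ^ 2) + PowerSeries.C ((if flag then 0 else u * b) + b) *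
          genFun r (segWt flag u b (a + 1)) + genFun r (segWt flag u b (a + 1)) ^ 2)) := by
    intro flag u b a ha
    have := congrArg (genFun r) (funext (segWt_eq flag u b a))
    rw [genFun_add, genFun_add, genFun_midConv ha, genFun_midConv ha, genFun_add, genFun_add,
      genFun_const_mul, genFun_const_mul, genFun_const_mul, genFun_nil, hN flag u b a ha] at this
    rw [this, map_add]
    ring
  have hEE : ∀ a, a < r → genFun r (segWt flag u b (a + 1)) =
      genFun r (segWt flag' u' b' (a + 1)) →
      genFun r (closedWt flag u b a) = genFun r (closedWt flag' u' b' a) := by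
    intro a ha hs
    have e1 := hE flag u b a ha
    have e2 := hE flag' u' b' a ha
    rw [← hs] at e2
    linear_combination genFun r (closedWt flag' u' b' a) * e1 - genFun r (closedWt flag u b a) * e2
  -- Letters are below `r`, so there are no segments at level `r`: this starts the downward
  -- induction on `a`.
  have htop : ∀ (flag : Prop) (u b : R), genFun r (segWt flag u b r) = 0 := by
    intro flag u b
    ext n
    rw [genFun, PowerSeries.coeff_mk, map_zero, ← wordSum_zero r n]
    refine wordSum_congr n fun s _ hs => if_neg ?_
    rintro ⟨⟨h, -, h'⟩, -⟩
    obtain ⟨m, hm⟩ := List.exists_mem_of_ne_nil s h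
    exact absurd (hs m hm) (h' m hm).not_gt
  have hseg : ∀ k a, a + k = r →
      genFun r (segWt flag u b a) = genFun r (segWt flag' u' b' a) := by
    intro k
    induction k with
    | zero => rintro a rfl; exact (htop flag u b).trans (htop flag' u' b').symm
    | succ k ih =>
      intro a hak
      have hlt : a < r := by omega
      have h := ih (a + 1) (by omega)
      rw [hG _ _ _ _ hlt, hG _ _ _ _ hlt, ← h, ← hEE a hlt h, h1, h2]
  exact hEE a ha (hseg (r - (a + 1)) (a + 1) (by omega))

end Grammar

/-! ### The recursive matching condition in terms of positions -/

section MatchedIndex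

theorem closes_iff (c : ℕ) (T : List ℕ) : Closes c T ↔ ∃ k, T[k]? = some c ∧
    (∀ e, T[k + 1]? = some e → e < c) ∧ ∀ m < k, ∀ d, T[m]? = some d → c ≤ d := by
  induction T with
  | nil => simp [Closes]
  | cons d T ih =>
    rw [Closes, ih]
    constructor
    · rintro (⟨rfl, h⟩ | ⟨h, k, h1, h2, h3⟩)
      · refine ⟨0, by simp, fun e he => h e ?_, by simp⟩
        simpa [List.head?_eq_getElem?] using he
      · refine ⟨k + 1, by simpa using h1, fun e he => h2 e (by simpa using he), ?_⟩
        intro m hm e he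
        cases m with
        | zero => simp at he; omega
        | succ m => exact h3 m (by omega) e (by simpa using he)
    · rintro ⟨k, h1, h2, h3⟩
      cases k with
      | zero =>
        refine Or.inl ⟨by simpa using h1, fun e he => h2 e ?_⟩
        simpa [List.head?_eq_getElem?] using he
      | succ k =>
        refine Or.inr ⟨h3 0 (by omega) d (by simp), k, by simpa using h1,
          fun e he => h2 e (by simpa using he), fun m hm e he => h3 (m + 1) (by omega) e
            (by simpa using he)⟩

theorem matched_iff (L : List ℕ) : Matched false L ↔ ∀ i p c q, L[i]? = some p →
    L[i + 1]? = some c → L[i + 2]? = some q → p < c → c < q → Closes c (L.drop (i + 2)) := by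
  match L with
  | [] => simp [Matched]
  | [a] => simp [Matched]
  | [a, b] => simp [Matched]
  | a :: b :: d :: s =>
    have h := matched_iff (b :: d :: s)
    have h1 : Matched false (a :: b :: d :: s) ↔ (a < b → b < d → Closes b (d :: s)) ∧
        Matched false (b :: d :: s) := by simp [Matched]
    rw [h1, h]
    constructor
    · rintro ⟨h2, h3⟩ i p c q hp hc hq
      cases i with
      | zero => simp at hp hc hq; subst hp hc hq; simpa using h2
      | succ i => simpa using h3 i p c q (by simpa using hp) (by simpa using hc) (by simpa using hq)
    · intro h2
      refine ⟨by simpa using h2 0 a b d, fun i p c q hp hc hq => ?_⟩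
      simpa using h2 (i + 1) p c q (by simpa using hp) (by simpa using hc) (by simpa using hq)

end MatchedIndex

/-! ### From functions on `Fin` to lists -/

section Bridge

/-- The list of entries of a word. -/
def wordList {n r : ℕ} (w : Fin n → Fin r) : List ℕ := List.ofFn fun i => (w i : ℕ)

theorem wordList_succ {n r : ℕ} (w : Fin (n + 1) → Fin r) :
    wordList w = (w 0 : ℕ) :: wordList fun i => w i.succ := by
  simp [wordList, List.ofFn_succ]

theorem wordList_getElem? {n r : ℕ} {w : Fin n → Fin r} {i a : ℕ} :
    (wordList w)[i]? = some a ↔ ∃ h : i < n, (w ⟨i, h⟩ : ℕ) = a := by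
  rw [wordList, List.getElem?_ofFn]
  split_ifs with h
  · simp [h]
  · simp [h]

theorem asc_eq_ascList {n r : ℕ} (w : Fin (n + 1) → Fin r) : asc w = ascList (wordList w) := by
  induction n with
  | zero => simp [asc, wordList, ascList]
  | succ n ih =>
    have := ih fun i => w i.succ
    rw [wordList_succ, wordList_succ] at *
    rw [ascList, ← this]
    simp only [asc, Finset.card_filter]
    rw [Fin.sum_univ_succ]
    rfl

theorem isChain_wordList {n r : ℕ} (w : Fin (n + 1) → Fin r) :
    (wordList w).IsChain (· ≠ ·) ↔ ∀ i : Fin n, w i.castSucc ≠ w i.succ := by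
  induction n with
  | zero => simp [wordList]
  | succ n ih =>
    have := ih fun i => w i.succ
    rw [wordList_succ, wordList_succ] at *
    rw [List.isChain_cons_cons, this, Fin.forall_fin_succ]
    simp [Fin.ext_iff]

theorem getLastD_wordList {n r : ℕ} (w : Fin (n + 1) → Fin r) (d : ℕ) :
    (wordList w).getLastD d = w (Fin.last n) := by
  induction n generalizing d with
  | zero => simp [wordList]
  | succ n ih =>
    rw [wordList_succ, List.getLastD_cons, ih]
    rfl

/-- `Closes` asks only for a descent after the matching entry. The descent into the next smaller
entry is a double descent because neighbours differ and all entries in between are at least `w_j`.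
-/
theorem doubleAscentsMatched_iff {n r : ℕ} (w : Fin (n + 1) → Fin r)
    (hc : ∀ i : Fin n, w i.castSucc ≠ w i.succ) (hl : (w (Fin.last n) : ℕ) = 0) :
    DoubleAscentsMatched w ↔ Matched false (wordList w) := by
  have hc' : ∀ i (h : i + 1 < n + 1), w ⟨i, by omega⟩ ≠ w ⟨i + 1, h⟩ :=
    fun i h => hc ⟨i, by omega⟩
  simp only [matched_iff, closes_iff, List.getElem?_drop, wordList_getElem?]
  constructor
  · rintro H i p c q ⟨hi, rfl⟩ ⟨hi1, rfl⟩ ⟨hi2, rfl⟩ h1 h2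
    obtain ⟨k, ⟨k1, k2, e1, e2, -, h4⟩, hjk, heq, hm⟩ :=
      H ⟨i + 1, hi1⟩ ⟨⟨i, hi⟩, ⟨i + 2, hi2⟩, rfl, rfl, h1, h2⟩
    have hk2 : (k : ℕ) ≠ i + 2 := by
      rintro e
      have : k = ⟨i + 2, hi2⟩ := Fin.ext e
      rw [heq, this] at h2
      exact absurd h2 (lt_irrefl _)
    have hlt : i + 1 < (k : ℕ) := hjk
    have hk := k.2
    refine ⟨(k : ℕ) - (i + 2), ⟨by omega, ?_⟩, ?_, ?_⟩
    · rw [heq]; congr 2; ext; simp; omega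
    · rintro e ⟨h, rfl⟩
      rw [heq]
      have : (⟨i + 2 + ((k : ℕ) - (i + 2) + 1), h⟩ : Fin (n + 1)) = k2 := by ext; simp; omega
      rw [this]
      exact h4
    · rintro m hmk d ⟨h, rfl⟩
      exact hm _ (by simp [Fin.lt_def]; omega) (by simp [Fin.lt_def]; omega)
  · rintro H ⟨j, hj⟩ ⟨⟨i, hi⟩, ⟨k, hk⟩, e1, e2, h1, h2⟩
    simp only at e1 e2
    subst e1 e2
    obtain ⟨k, ⟨hk1, hk2⟩, h3, h4⟩ := H i _ _ _ ⟨hi, rfl⟩ ⟨hj, rfl⟩ ⟨hk, rfl⟩ h1 h2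
    have hpos : 0 < (w ⟨i + 1, hj⟩ : ℕ) := by
      have := Fin.lt_def.1 h1; omega
    -- The matching entry exceeds a predecessor of `j`, hence is positive, while the last letter is
    -- `0`; so the end-of-word case of `Closes` does not occur.
    have hkn : i + 2 + k ≠ n := by
      intro e
      have : (⟨i + 2 + k, hk1⟩ : Fin (n + 1)) = Fin.last n := Fin.ext e
      rw [this, hl] at hk2
      omega
    have hge : (w ⟨i + 1, hj⟩ : ℕ) ≤ w ⟨i + 1 + k, by omega⟩ := by
      cases k with
      | zero => exact le_rfl
      | succ k =>
        have := h4 k (by omega) _ ⟨by omega, rfl⟩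
        convert this using 4
        omega
    have hne := hc' (i + 1 + k) (by omega)
    have heq : (⟨i + 1 + k + 1, by omega⟩ : Fin (n + 1)) = ⟨i + 2 + k, hk1⟩ := by ext; simp; omega
    rw [heq] at hne
    have hne' : (w ⟨i + 1 + k, by omega⟩ : ℕ) ≠ w ⟨i + 2 + k, hk1⟩ := fun e => hne (Fin.ext e)
    refine ⟨⟨i + 2 + k, hk1⟩, ⟨⟨i + 1 + k, by omega⟩, ⟨i + 2 + k + 1, by omega⟩, ?_, rfl, ?_, ?_⟩,
      ?_, Fin.ext hk2.symm, ?_⟩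
    · simp; omega
    · rw [Fin.lt_def]; omega
    · rw [Fin.lt_def, hk2]; exact h3 _ ⟨by omega, rfl⟩
    · simp [Fin.lt_def]; omega
    · rintro ⟨m, hm⟩ hm1 hm2
      simp only [Fin.lt_def] at hm1 hm2
      have := h4 (m - (i + 2)) (by omega) (w ⟨m, hm⟩) ⟨by omega, by congr 2; ext; simp; omega⟩
      exact this

variable {R : Type*} [CommRing R]

theorem sum_wordList (r : ℕ) (n : ℕ) (φ : List ℕ → R) :
    ∑ w : Fin n → Fin r, φ (wordList w) = wordSum r φ n := by
  induction n generalizing φ with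
  | zero => simp [wordList, wordSum]
  | succ n ih =>
    rw [← (Fin.consEquiv fun _ => Fin r).sum_comp, Fintype.sum_prod_type, wordSum,
      ← Fin.sum_univ_eq_sum_range (fun d => wordSum r (fun s => φ (d :: s)) n)]
    refine Finset.sum_congr rfl fun d _ => ?_
    rw [← ih]
    refine Finset.sum_congr rfl fun w _ => ?_
    rw [wordList_succ]
    simp [Fin.consEquiv]

open Classical in
theorem sum_smirnovWords (flag : Prop) (u b : R) (n : ℕ) {r : ℕ} (hr : 1 ≤ r) :
    ∑ w ∈ (smirnovWords n r).filter (fun w => flag → DoubleAscentsMatched w),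
      u ^ asc w * b ^ n = wordSum r (closedWt flag u b 0) n := by
  -- Restore the forced initial letter `w_0 = 0`, so that both sums run over words of length `n +
  -- 1`.
  have h1 : wordSum r (closedWt flag u b 0) n = wordSum r (fun L => match L with
      | [] => 0
      | d :: B => if d = 0 then closedWt flag u b 0 B else 0) (n + 1) := by
    rw [wordSum, Finset.sum_eq_single 0]
    · simp
    · intro d _ hd; simp [hd, wordSum_zero]
    · intro h; exact absurd (Finset.mem_range.2 hr) h
  rw [h1, ← sum_wordList, Finset.sum_filter, smirnovWords, Finset.sum_filter]
  refine Finset.sum_congr rfl fun w _ => ?_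
  have hcons := wordList_succ w
  have hlen : (wordList fun i => w (Fin.succ i)).length = n := by simp [wordList]
  have hlast := getLastD_wordList w 0
  have hchain := isChain_wordList w
  have hasc := asc_eq_ascList w
  have hmat := doubleAscentsMatched_iff w
  rw [hcons] at hlast hchain hasc hmat ⊢
  rw [List.getLastD_cons] at hlast
  simp only
  by_cases h0 : (w 0 : ℕ) = 0
  · rw [h0] at hlast hchain hasc hmat ⊢
    rw [if_pos rfl, closedWt, ← ite_and, hasc, hlen, hlast]
    refine ite_zero_congr ?_ rfl
    unfold IsTail
    rw [hchain]
    simp only [Nat.zero_le, implies_true, and_true, true_and]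
    constructor
    · rintro ⟨⟨h2, h3⟩, h4⟩
      exact ⟨h3, h2, fun h => (hmat h3 h2).1 (h4 h)⟩
    · rintro ⟨h3, h2, h4⟩
      exact ⟨⟨h2, h3⟩, fun h => (hmat h3 h2).2 (h4 h)⟩
  · rw [if_neg h0, if_neg (fun h => h0 h.1)]

end Bridge

/-! ### Smirnov words as walks modulo `r` -/

section Residues

open Classical in
/-- Weight `x ^ asc` of the word following an entry `c`, with last entry `0`. -/
noncomputable def pathWt (c : ℕ) (s : List ℕ) : ℝ[X] :=
  if (c :: s).IsChain (· ≠ ·) ∧ s.getLastD c = 0 then X ^ ascList (c :: s) else 0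

theorem pathWt_cons (c d : ℕ) (s : List ℕ) : pathWt c (d :: s) =
    (if c = d then 0 else if c < d then X else 1) * pathWt d s := by
  unfold pathWt
  simp only [List.isChain_cons_cons, List.getLastD_cons, ascList]
  by_cases h : c = d
  · simp [h]
  · by_cases h' : c < d
    · simp [h, h', pow_add, -List.getLastD_eq_getLast?]
    · simp [h, h']

/-- A step from `c` to `d` selects the exponent `i` in `[1, r-1]` congruent to `c - d` modulo `r`.
It is `c - d` for a descent and `c - d + r` for an ascent, so a walk from `c` to `0` with `k`
ascents has exponent sum `rk + c`. -/
theorem coeff_wordSum_pathWt (r n : ℕ) : ∀ c < r, ∀ k, (wordSum r (pathWt c) n).coeff k =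
    ((∑ i ∈ Finset.Icc 1 (r - 1), (X : ℝ[X]) ^ i) ^ n).coeff (r * k + c) := by
  induction n with
  | zero =>
    intro c hc k
    have hr : r ≠ 0 := by omega
    by_cases h0 : c = 0 <;>
      simp [wordSum, pathWt, h0, ascList, coeff_one, hr]
  | succ n ih =>
    intro c hc k
    set A := ∑ i ∈ Finset.Icc 1 (r - 1), (X : ℝ[X]) ^ i with hA
    have h1 : (wordSum r (pathWt c) (n + 1)).coeff k = ∑ d ∈ (Finset.range r).erase c,
        (if c < d then X * wordSum r (pathWt d) n else wordSum r (pathWt d) n).coeff k := by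
      rw [wordSum, finsetSum_coeff]
      simp only [pathWt_cons, wordSum_const_mul]
      rw [← Finset.add_sum_erase _ _ (Finset.mem_range.2 hc)]
      simp only [if_true, zero_mul, coeff_zero, zero_add]
      refine Finset.sum_congr rfl fun d hd => ?_
      rw [if_neg (Finset.ne_of_mem_erase hd).symm]
      split_ifs <;> simp
    rw [h1, pow_succ, hA, Finset.mul_sum, ← hA, finsetSum_coeff]
    simp only [coeff_mul_X_pow']
    refine Finset.sum_bij' (fun d _ => if c < d then c + r - d else c - d)
      (fun i _ => if i ≤ c then c - i else c + r - i) ?_ ?_ ?_ ?_ ?_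
    · intro d hd
      simp only [Finset.mem_erase, Finset.mem_range] at hd
      simp only [Finset.mem_Icc]
      split_ifs <;> omega
    · intro i hi
      simp only [Finset.mem_Icc] at hi
      simp only [Finset.mem_erase, Finset.mem_range]
      split_ifs <;> omega
    · intro d hd
      simp only [Finset.mem_erase, Finset.mem_range] at hd
      split_ifs <;> omega
    · intro i hi
      simp only [Finset.mem_Icc] at hi
      split_ifs <;> omega
    · intro d hd
      simp only [Finset.mem_erase, Finset.mem_range] at hd
      by_cases hcd : c < d
      · rw [if_pos hcd, if_pos hcd]
        cases k with
        | zero => rw [if_neg (by omega), coeff_X_mul_zero]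
        | succ k =>
          rw [coeff_X_mul, ih d hd.2, if_pos (by rw [mul_add]; omega)]
          congr 1
          rw [mul_add]; omega
      · rw [if_neg hcd, if_neg hcd, ih d hd.2, if_pos (by omega)]
        congr 1
        omega

theorem coeff_E {r : ℕ} (hr : 1 ≤ r) (p : ℝ[X]) (k : ℕ) : (E r p).coeff k = p.coeff (r * k) := by
  induction p using Polynomial.induction_on' with
  | add p q hp hq => simp [hp, hq]
  | monomial m a =>
    rw [E, Polynomial.lsum_apply, Polynomial.sum_monomial_index _ _ (by simp)]
    split_ifs with h
    · obtain ⟨m, rfl⟩ := h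
      rw [Nat.mul_div_cancel_left _ hr, coeff_monomial, coeff_monomial]
      simp [Nat.ne_of_gt hr]
    · rw [coeff_monomial, if_neg]
      · rfl
      · rintro rfl; exact h (dvd_mul_right _ _)

theorem E_pow_eq_sum_smirnovWords (n : ℕ) {r : ℕ} (hr : 1 ≤ r) :
    E r ((∑ k ∈ Finset.Icc 1 (r - 1), (X : ℝ[X]) ^ k) ^ n) =
      ∑ w ∈ smirnovWords n r, (X : ℝ[X]) ^ asc w := by
  classical
  have h := sum_smirnovWords False (X : ℝ[X]) 1 n hr
  simp only [false_imp_iff, Finset.filter_true, one_pow, mul_one] at h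
  rw [h]
  have h2 : closedWt False (X : ℝ[X]) 1 0 = pathWt 0 := by
    funext s
    simp [closedWt, pathWt, IsTail]
  ext k
  rw [h2, coeff_wordSum_pathWt r n 0 hr, coeff_E hr, add_zero]

end Residues

/-! ### Trading all words for matched words at a real point -/

section Gamma

open Classical in
theorem sum_smirnovWords_matched {x : ℝ} (hx : 1 + x ≠ 0) (n : ℕ) {r : ℕ} (hr : 1 ≤ r) :
    ∑ w ∈ smirnovWords n r, x ^ asc w = ∑ w ∈ (smirnovWords n r).filter DoubleAscentsMatched,
      (x / (1 + x) ^ 2) ^ asc w * (1 + x) ^ n := by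
  have h1 := sum_smirnovWords False x 1 n hr
  have h2 := sum_smirnovWords True (x / (1 + x) ^ 2) (1 + x) n hr
  have h := genFun_closedWt_eq (flag := False) (flag' := True) x 1
    (u' := x / (1 + x) ^ 2) (b' := 1 + x) (by field_simp) (by simp [add_comm]) 0 hr
  simp only [false_imp_iff, Finset.filter_true, one_pow, mul_one, true_imp_iff] at h1 h2
  rw [h1, h2]
  simpa [genFun] using congrArg (PowerSeries.coeff n) h

end Gamma

/-! ### The gamma expansion and its uniqueness -/

section GammaExpansion

theorem asc_le {n r : ℕ} (w : Fin (n + 1) → Fin r) : asc w ≤ n :=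
  (Finset.card_filter_le _ _).trans (by simp)

theorem sum_asc_mul_pow (n : ℕ) {r : ℕ} (hr : 1 ≤ r) :
    (∑ w ∈ smirnovWords n r, (X : ℝ[X]) ^ asc w) * (1 + X) ^ n =
      ∑ i ∈ Finset.range (n + 1), C (xi n r i : ℝ) * X ^ i * (1 + X) ^ (2 * (n - i)) := by
  classical
  refine Polynomial.eq_of_infinite_eval_eq _ _ ((Set.Ioi_infinite (0 : ℝ)).mono fun x hx => ?_)
  have hx1 : 1 + x ≠ 0 := by have : 0 < x := hx; positivity
  simp only [Set.mem_ofPred_eq, eval_mul, eval_finsetSum, eval_pow, eval_X, eval_add, eval_one,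
    eval_C]
  rw [sum_smirnovWords_matched hx1 n hr, ← Finset.sum_fiberwise_of_maps_to (g := asc)
    (t := Finset.range (n + 1)) (fun w _ => Finset.mem_range.2 (Nat.lt_succ_of_le (asc_le w))),
    Finset.sum_mul]
  refine Finset.sum_congr rfl fun i hi => ?_
  have hi' : i ≤ n := Nat.lt_succ_iff.1 (Finset.mem_range.1 hi)
  have h1 : ∑ w ∈ ((smirnovWords n r).filter DoubleAscentsMatched).filter (fun w => asc w = i),
      (x / (1 + x) ^ 2) ^ asc w * (1 + x) ^ n = xi n r i * ((x / (1 + x) ^ 2) ^ i * (1 + x) ^ n) := by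
    rw [Finset.sum_congr rfl (g := fun _ => (x / (1 + x) ^ 2) ^ i * (1 + x) ^ n)
      (fun w hw => by rw [(Finset.mem_filter.1 hw).2]), Finset.sum_const, nsmul_eq_mul,
      Finset.filter_filter, xi]
    simp only [and_comm]
  rw [h1, div_pow]
  obtain ⟨m, rfl⟩ := Nat.exists_eq_add_of_le hi'
  rw [Nat.add_sub_cancel_left]
  generalize 1 + x = y at hx1
  field_simp
  ring

/-- An algebraic argument replaces the count of peaks. Once the higher coefficients vanish, a power
of `1 + X` cancels in `sum_asc_mul_pow`; at `-1` the left side is then `0`, and on the right only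
the `i`-th term survives. -/
theorem xi_eq_zero {n r : ℕ} (hr : 1 ≤ r) {i : ℕ} (hi : n < 2 * i) : xi n r i = 0 := by
  classical
  by_cases hin : n < i
  · unfold xi
    refine Finset.card_eq_zero.2 (Finset.eq_empty_of_forall_notMem fun w hw => ?_)
    rw [Finset.mem_filter] at hw
    have h := hw.2.1
    have := asc_le w
    omega
  rw [not_lt] at hin
  induction hk : n - i using Nat.strong_induction_on generalizing i with
  | _ k ih =>
    have hgt : ∀ j, i < j → j ≤ n → xi n r j = 0 := fun j hij hj =>
      ih (n - j) (by omega) (by omega) hj rfl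
    have h := sum_asc_mul_pow n hr
    have hsub : Finset.range (i + 1) ⊆ Finset.range (n + 1) :=
      Finset.range_subset_range.2 (by omega)
    rw [← Finset.sum_subset hsub (fun j hj hj' => by
      rw [Finset.mem_range] at hj hj'
      rw [hgt j (by omega) (by omega)]; simp)] at h
    have h1 : (1 + X : ℝ[X]) ≠ 0 := by
      intro e
      have := congrArg (eval 0) e
      simp at this
    have h2 : (∑ w ∈ smirnovWords n r, (X : ℝ[X]) ^ asc w) * (1 + X) ^ (2 * i - n) =
        ∑ j ∈ Finset.range (i + 1), C (xi n r j : ℝ) * X ^ j * (1 + X) ^ (2 * (i - j)) := by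
      apply mul_right_cancel₀ (pow_ne_zero (2 * (n - i)) h1)
      rw [mul_assoc, ← pow_add, show 2 * i - n + 2 * (n - i) = n by omega, h, Finset.sum_mul]
      refine Finset.sum_congr rfl fun j hj => ?_
      rw [Finset.mem_range] at hj
      rw [mul_assoc (_ * _), ← pow_add]
      congr 2
      omega
    have h3 := congrArg (eval (-1)) h2
    rw [eval_mul, eval_pow, eval_add, eval_one, eval_X, add_neg_cancel,
      zero_pow (by omega), mul_zero, eval_finsetSum, Finset.sum_eq_single i] at h3
    · simpa using h3
    · intro j hj hji
      rw [Finset.mem_range] at hj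
      rw [eval_mul, eval_pow, eval_add, eval_one, eval_X, add_neg_cancel, zero_pow (by omega),
        mul_zero]
    · simp

theorem sum_asc_eq_gamma (n : ℕ) {r : ℕ} (hr : 1 ≤ r) :
    ∑ w ∈ smirnovWords n r, (X : ℝ[X]) ^ asc w =
      ∑ i ∈ Finset.range (n / 2 + 1), C (xi n r i : ℝ) * X ^ i * (1 + X) ^ (n - 2 * i) := by
  have h1 : (1 + X : ℝ[X]) ≠ 0 := by
    intro e
    have := congrArg (eval 0) e
    simp at this
  apply mul_right_cancel₀ (pow_ne_zero n h1)
  have hsub : Finset.range (n / 2 + 1) ⊆ Finset.range (n + 1) :=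
    Finset.range_subset_range.2 (by omega)
  rw [sum_asc_mul_pow n hr, Finset.sum_mul, ← Finset.sum_subset hsub (fun j hj hj' => by
      rw [Finset.mem_range] at hj hj'
      rw [xi_eq_zero hr (by omega)]; simp)]
  refine Finset.sum_congr rfl fun j hj => ?_
  rw [Finset.mem_range] at hj
  rw [mul_assoc, mul_assoc, mul_assoc, ← pow_add, show 2 * (n - j) = n - 2 * j + n by omega]

/-- The system is triangular: `X^i (1+X)^(n-2i)` has lowest term `X^i` with coefficient `1`. -/
theorem gamma_coeff_unique {m n : ℕ} {a b : ℕ → ℝ}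
    (h : ∑ i ∈ Finset.range m, C (a i) * X ^ i * (1 + X) ^ (n - 2 * i) =
      ∑ i ∈ Finset.range m, C (b i) * X ^ i * (1 + X) ^ (n - 2 * i)) :
    ∀ i < m, a i = b i := by
  have hc : ∀ (c : ℝ) (i j : ℕ), (C c * X ^ j * (1 + X) ^ (n - 2 * j)).coeff i =
      if j ≤ i then c * ((1 + X : ℝ[X]) ^ (n - 2 * j)).coeff (i - j) else 0 := by
    intro c i j
    rw [mul_assoc, coeff_C_mul, coeff_X_pow_mul']
    split_ifs <;> simp
  intro i
  induction i using Nat.strong_induction_on with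
  | _ i ih =>
    intro hi
    have h' := congrArg (fun p => coeff p i) h
    simp only [finsetSum_coeff, hc] at h'
    rw [← Finset.add_sum_erase _ _ (Finset.mem_range.2 hi),
      ← Finset.add_sum_erase _ _ (Finset.mem_range.2 hi)] at h'
    have e : ∑ j ∈ (Finset.range m).erase i,
        (if j ≤ i then a j * ((1 + X : ℝ[X]) ^ (n - 2 * j)).coeff (i - j) else 0) =
        ∑ j ∈ (Finset.range m).erase i,
        (if j ≤ i then b j * ((1 + X : ℝ[X]) ^ (n - 2 * j)).coeff (i - j) else 0) := by
      refine Finset.sum_congr rfl fun j hj => ?_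
      split_ifs with hji
      · rw [ih j (lt_of_le_of_ne hji (Finset.ne_of_mem_erase hj))
          (Finset.mem_range.1 (Finset.mem_of_mem_erase hj))]
      · rfl
    rw [e] at h'
    have := add_right_cancel h'
    simpa [coeff_zero_eq_eval_zero] using this

end GammaExpansion

/-! ### Multisets on faces and lattice vectors -/

section Vertices

/-- The sum of the vertices of a face, taken with multiplicities. -/
noncomputable def weightedSum {V : Type*} : ((V → ℕ) →₀ ℕ) →ₗ[ℕ] (V → ℕ) := Finsupp.linearCombination ℕ id

theorem weightedSum_apply {V : Type*} (l : (V → ℕ) →₀ ℕ) (i : V) :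
    weightedSum l i = ∑ v ∈ l.support, l v * v i := by
  simp [weightedSum, Finsupp.linearCombination_apply, Finsupp.sum]

/-- A telescoping sum along the order; monotonicity keeps the natural subtraction exact. -/
theorem sum_sub_of_monotone {V : Type*} [LinearOrder V] {g : ℕ → ℕ} (hg : Monotone g) (h0 : g 0 = 0) (u : V → ℕ)
    (s : Finset V) : ∑ i ∈ s, (g (∑ j ∈ s.filter (· ≤ i), u j) - g (∑ j ∈ s.filter (· < i), u j)) =
      g (∑ i ∈ s, u i) := by
  induction s using Finset.induction_on_max with
  | empty => simp [h0]
  | insert a s ha ih =>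
    have has : a ∉ s := fun h => lt_irrefl _ (ha a h)
    rw [Finset.sum_insert has, Finset.sum_insert has]
    have e1 : (insert a s).filter (· ≤ a) = insert a s :=
      Finset.filter_true_of_mem fun i hi => by
        rcases Finset.mem_insert.1 hi with rfl | hi
        exacts [le_rfl, (ha i hi).le]
    have e2 : (insert a s).filter (· < a) = s := by
      rw [Finset.filter_insert, if_neg (lt_irrefl a), Finset.filter_true_of_mem ha]
    have e3 : ∑ i ∈ s, (g (∑ j ∈ (insert a s).filter (· ≤ i), u j) -
        g (∑ j ∈ (insert a s).filter (· < i), u j)) = g (∑ i ∈ s, u i) := by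
      rw [← ih]
      refine Finset.sum_congr rfl fun i hi => ?_
      rw [Finset.filter_insert, if_neg (ha i hi).not_ge, Finset.filter_insert,
        if_neg (ha i hi).not_gt]
    rw [e1, e2, e3, Finset.sum_insert has]
    exact Nat.sub_add_cancel (hg (Nat.le_add_left _ _))

/-- Hermite's identity. -/
theorem sum_range_add_div {k : ℕ} (hk : 0 < k) (x : ℕ) :
    ∑ j ∈ Finset.range k, (x + j) / k = x := by
  induction x with
  | zero =>
    refine Finset.sum_eq_zero fun j hj => ?_
    rw [zero_add, Nat.div_eq_of_lt (Finset.mem_range.1 hj)]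
  | succ x ih =>
    have h1 := Finset.sum_range_succ (fun j => (x + j) / k) k
    have h2 := Finset.sum_range_succ' (fun j => (x + j) / k) k
    rw [h1, ih, Nat.add_div_right _ hk] at h2
    have h3 : ∑ j ∈ Finset.range k, (x + 1 + j) / k = ∑ j ∈ Finset.range k, (x + (j + 1)) / k :=
      Finset.sum_congr rfl fun j _ => by congr 1; omega
    rw [h3]
    simp only [add_zero] at h2
    omega

variable {V : Type*} [Fintype V] [LinearOrder V]

theorem sum_filter_le_eq (u : V → ℕ) (i : V) :
    partialSums u i = ∑ j ∈ Finset.univ.filter (· < i), u j + u i := by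
  rw [partialSums, ← Finset.sum_erase_add _ _ (show i ∈ Finset.univ.filter (· ≤ i) by simp)]
  congr 2
  ext j
  simp [lt_iff_le_and_ne, and_comm]

theorem partialSums_injective : Function.Injective (partialSums : (V → ℕ) → V → ℕ) := by
  intro u v h
  funext i
  induction i using WellFoundedLT.induction with
  | _ i ih =>
    have h1 := congrFun h i
    have h2 : ∑ j ∈ Finset.univ.filter (· < i), u j = ∑ j ∈ Finset.univ.filter (· < i), v j :=
      Finset.sum_congr rfl fun j hj => ih j (Finset.mem_filter.1 hj).2
    rw [sum_filter_le_eq, sum_filter_le_eq] at h1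
    omega

theorem partialSums_weightedSum (l : (V → ℕ) →₀ ℕ) (i : V) :
    partialSums (weightedSum l) i = ∑ v ∈ l.support, l v * partialSums v i := by
  simp only [partialSums, weightedSum_apply, Finset.mul_sum]
  exact Finset.sum_comm

/-- A vertex with least total of partial sums works: any `w` with `Step w v` lies below it
coordinatewise, so it has the same partial sums. -/
theorem exists_forall_step {G : Finset (V → ℕ)} (hG : G.Nonempty)
    (h : ∀ u ∈ G, ∀ v ∈ G, Step u v ∨ Step v u) : ∃ v ∈ G, ∀ w ∈ G, Step v w := by
  obtain ⟨v, hv, hmin⟩ := G.exists_min_image (fun v => ∑ i, partialSums v i) hG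
  refine ⟨v, hv, fun w hw => ?_⟩
  rcases h v hv w hw with h1 | h1
  · exact h1
  · have hle : ∀ i ∈ Finset.univ, partialSums w i ≤ partialSums v i := fun i _ => by
      rcases h1 i with h | h <;> omega
    have heq := (Finset.sum_eq_sum_iff_of_le hle).1
      (le_antisymm (Finset.sum_le_sum hle) (hmin w hw))
    exact fun i => Or.inl (heq i (Finset.mem_univ i))

/-- Each vertex contributes `p` or `p + 1`, where `p` is the partial sum of `v`, and `v` itself
contributes `p`. The total thus lies in `[kp, kp + k)`, with `k` the degree. -/
theorem partialSums_eq_div {l : (V → ℕ) →₀ ℕ} {v : V → ℕ} (hv : v ∈ l.support)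
    (h : ∀ w ∈ l.support, Step v w) (i : V) :
    partialSums v i = partialSums (weightedSum l) i / l.degree := by
  have hl : l v ≠ 0 := Finsupp.mem_support_iff.1 hv
  symm
  rw [partialSums_weightedSum, Finsupp.degree_apply]
  apply Nat.div_eq_of_lt_le
  · rw [mul_comm, Finset.sum_mul]
    refine Finset.sum_le_sum fun w hw => Nat.mul_le_mul_left _ ?_
    rcases h w hw i with h | h <;> omega
  · rw [mul_comm, Finset.sum_mul]
    refine Finset.sum_lt_sum (fun w hw => Nat.mul_le_mul_left _ ?_) ⟨v, hv, ?_⟩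
    · rcases h w hw i with h | h <;> omega
    · exact Nat.mul_lt_mul_of_pos_left (by omega) (Nat.pos_of_ne_zero hl)

/-- The smallest vertex depends only on the sum and the degree; remove one copy of it and induct. -/
theorem weightedSum_injOn (k : ℕ) : ∀ l l' : (V → ℕ) →₀ ℕ,
    (∀ u ∈ l.support, ∀ v ∈ l.support, Step u v ∨ Step v u) →
    (∀ u ∈ l'.support, ∀ v ∈ l'.support, Step u v ∨ Step v u) →
    l.degree = k → l'.degree = k → weightedSum l = weightedSum l' → l = l' := by
  induction k with
  | zero =>
    intro l l' _ _ h h' _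
    rw [(Finsupp.degree_eq_zero_iff l).1 h, (Finsupp.degree_eq_zero_iff l').1 h']
  | succ k ih =>
    intro l l' hl hl' hd hd' he
    have hne : ∀ l : (V → ℕ) →₀ ℕ, l.degree = k + 1 → l.support.Nonempty := by
      intro l h
      rw [Finsupp.support_nonempty_iff]
      rintro rfl
      simp at h
    obtain ⟨v, hv, hmin⟩ := exists_forall_step (hne l hd) hl
    obtain ⟨v', hv', hmin'⟩ := exists_forall_step (hne l' hd') hl'
    have hvv : v = v' := partialSums_injective (funext fun i => by
      rw [partialSums_eq_div hv hmin, partialSums_eq_div hv' hmin', hd, hd', he])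
    subst hvv
    have hle : ∀ l : (V → ℕ) →₀ ℕ, v ∈ l.support → l = (l - Finsupp.single v 1) +
        Finsupp.single v 1 := fun l h => by
      rw [tsub_add_cancel_of_le]
      rw [Finsupp.single_le_iff]
      exact Nat.one_le_iff_ne_zero.2 (Finsupp.mem_support_iff.1 h)
    have hsub : ∀ l : (V → ℕ) →₀ ℕ, (l - Finsupp.single v 1).support ⊆ l.support := fun l =>
      Finsupp.support_tsub
    have e := hle l hv
    have e' := hle l' hv'
    rw [e, e']
    congr 1
    apply ih
    · exact fun u hu w hw => hl u (hsub l hu) w (hsub l hw)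
    · exact fun u hu w hw => hl' u (hsub l' hu) w (hsub l' hw)
    · rw [e, map_add, Finsupp.degree_single] at hd; omega
    · rw [e', map_add, Finsupp.degree_single] at hd'; omega
    · rw [e, e', map_add, map_add] at he
      exact add_right_cancel he

/-- The vector whose partial sums are `(P + j) / k`, where `P` are the partial sums of `u`. -/
def levelVertex (u : V → ℕ) (k j : ℕ) (i : V) : ℕ :=
  (partialSums u i + j) / k - (∑ j ∈ Finset.univ.filter (· < i), u j + j) / k

theorem partialSums_levelVertex (u : V → ℕ) {k j : ℕ} (hj : j < k) (i : V) :
    partialSums (levelVertex u k j) i = (partialSums u i + j) / k := by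
  have h := sum_sub_of_monotone (g := fun x => (x + j) / k)
    (fun x y hxy => Nat.div_le_div_right (Nat.add_le_add_right hxy _))
    (by rw [zero_add, Nat.div_eq_of_lt hj]) u (Finset.univ.filter (· ≤ i))
  rw [partialSums, partialSums, ← h]
  refine Finset.sum_congr rfl fun a ha => ?_
  have ha' : a ≤ i := (Finset.mem_filter.1 ha).2
  rw [levelVertex, partialSums, Finset.filter_filter, Finset.filter_filter]
  have e1 : (Finset.univ.filter fun b => b ≤ i ∧ b ≤ a) = Finset.univ.filter (· ≤ a) := by
    ext b; simp only [Finset.mem_filter, Finset.mem_univ, true_and]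
    exact ⟨fun h => h.2, fun h => ⟨h.trans ha', h⟩⟩
  have e2 : (Finset.univ.filter fun b => b ≤ i ∧ b < a) = Finset.univ.filter (· < a) := by
    ext b; simp only [Finset.mem_filter, Finset.mem_univ, true_and]
    exact ⟨fun h => h.2, fun h => ⟨h.le.trans ha', h⟩⟩
  rw [e1, e2]

theorem sum_levelVertex (u : V → ℕ) {k j : ℕ} (hj : j < k) :
    ∑ i, levelVertex u k j i = (∑ i, u i + j) / k := by
  have h := sum_sub_of_monotone (g := fun x => (x + j) / k)
    (fun x y hxy => Nat.div_le_div_right (Nat.add_le_add_right hxy _))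
    (by rw [zero_add, Nat.div_eq_of_lt hj]) u Finset.univ
  exact h

theorem levelVertex_eq_zero {u : V → ℕ} {i : V} (h : u i = 0) (k j : ℕ) :
    levelVertex u k j i = 0 := by
  rw [levelVertex, sum_filter_le_eq, h, add_zero, Nat.sub_self]

theorem step_levelVertex (u : V → ℕ) {k j j' : ℕ} (hj : j ≤ j') (hj' : j' < k) :
    Step (levelVertex u k j) (levelVertex u k j') := by
  intro i
  have hk : 0 < k := by omega
  rw [partialSums_levelVertex u hj', partialSums_levelVertex u (hj.trans_lt hj')]
  have h1 : (partialSums u i + j) / k ≤ (partialSums u i + j') / k :=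
    Nat.div_le_div_right (by omega)
  have h2 : (partialSums u i + j') / k ≤ (partialSums u i + j + k) / k :=
    Nat.div_le_div_right (by omega)
  rw [Nat.add_div_right _ hk] at h2
  omega

theorem sum_levelVertex_apply (u : V → ℕ) {k : ℕ} (hk : 0 < k) (i : V) :
    ∑ j ∈ Finset.range k, levelVertex u k j i = u i := by
  have h : ∀ j, (∑ j ∈ Finset.univ.filter (· < i), u j + j) / k ≤ (partialSums u i + j) / k :=
    fun j => Nat.div_le_div_right (by rw [sum_filter_le_eq]; omega)
  simp only [levelVertex]
  rw [Finset.sum_tsub_distrib _ fun j _ => h j, sum_range_add_div hk, sum_range_add_div hk,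
    sum_filter_le_eq, Nat.add_sub_cancel_left]

theorem exists_weightedSum_eq (u : V → ℕ) {k r : ℕ} (hk : 0 < k) (hu : ∑ i, u i = r * k) :
    ∃ l : (V → ℕ) →₀ ℕ, weightedSum l = u ∧ l.degree = k ∧
      (∀ u ∈ l.support, ∀ v ∈ l.support, Step u v ∨ Step v u) ∧
      (∀ v ∈ l.support, ∑ i, v i = r) ∧ ∀ v ∈ l.support, ∀ i, u i = 0 → v i = 0 := by
  classical
  set l : (V → ℕ) →₀ ℕ := ∑ j ∈ Finset.range k, Finsupp.single (levelVertex u k j) 1 with hl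
  have hsupp : ∀ v ∈ l.support, ∃ j < k, levelVertex u k j = v := by
    intro v hv
    obtain ⟨j, hj, h⟩ := Finset.mem_biUnion.1 (Finsupp.support_finsetSum hv)
    have := Finsupp.support_single_subset h
    exact ⟨j, Finset.mem_range.1 hj, (Finset.mem_singleton.1 this).symm⟩
  refine ⟨l, ?_, ?_, ?_, ?_, ?_⟩
  · rw [hl, map_sum]
    funext i
    rw [Finset.sum_apply, ← sum_levelVertex_apply u hk i]
    exact Finset.sum_congr rfl fun j _ => by simp [weightedSum]
  · rw [hl, map_sum]
    simp [Finsupp.degree_single]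
  · intro v hv w hw
    obtain ⟨j, hj, rfl⟩ := hsupp v hv
    obtain ⟨j', hj', rfl⟩ := hsupp w hw
    rcases le_total j j' with h | h
    · exact Or.inl (step_levelVertex u h hj')
    · exact Or.inr (step_levelVertex u h hj)
  · intro v hv
    obtain ⟨j, hj, rfl⟩ := hsupp v hv
    rw [sum_levelVertex u hj, hu, mul_comm, Nat.mul_add_div hk, Nat.div_eq_of_lt hj, add_zero]
  · intro v hv i hi
    obtain ⟨j, hj, rfl⟩ := hsupp v hv
    exact levelVertex_eq_zero hi k j

theorem mem_insert_faces_restrict_iff {r : ℕ} (hr : 1 ≤ r) (F : Finset V) (G : Finset (V → ℕ)) :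
    G ∈ insert ∅ ((edgewise (simplex V) r).restrict F).faces ↔
      (∀ u ∈ G, ∑ i, u i = r) ∧ (∀ u ∈ G, ∀ v ∈ G, Step u v ∨ Step v u) ∧
      ∀ u ∈ G, ∀ i ∉ F, u i = 0 := by
  have hcar : G.biUnion supp ⊆ F ↔ ∀ u ∈ G, ∀ i ∉ F, u i = 0 := by
    rw [Finset.biUnion_subset]
    refine forall₂_congr fun u _ => ⟨fun h i hi => ?_, fun h i hi => ?_⟩
    · by_contra h'
      exact hi (h (by simpa [supp] using h'))
    · by_contra h'
      exact (Finset.mem_filter.1 hi).2 (h i h')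
  rw [← hcar]
  constructor
  · rintro (rfl | ⟨⟨h1, -, h2⟩, h3⟩)
    · simp
    · exact ⟨h1, h2, h3⟩
  · rintro ⟨h1, h2, h3⟩
    rcases G.eq_empty_or_nonempty with rfl | ⟨u, hu⟩
    · exact Or.inl rfl
    · refine Or.inr ⟨⟨h1, ?_, h2⟩, h3⟩
      have : ∑ i, u i ≠ 0 := by rw [h1 u hu]; omega
      obtain ⟨i, -, hi⟩ := Finset.exists_ne_zero_of_sum_ne_zero this
      exact ⟨i, Finset.mem_biUnion.2 ⟨u, hu, by simpa [supp] using hi⟩⟩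

/-- Multisets of `k` vertices which span a face of the subdivision are equinumerous with vectors
of coordinate sum `r * k`. -/
theorem card_weighted_faces {r : ℕ} (hr : 1 ≤ r) (F : Finset V)
    (𝒦 : Finset (Finset (V → ℕ)))
    (h𝒦 : ∀ G, G ∈ 𝒦 ↔ G ∈ insert ∅ ((edgewise (simplex V) r).restrict F).faces) (k : ℕ) :
    ∑ G ∈ 𝒦, ((Finset.finsuppAntidiag G k).filter fun l => l.support = G).card =
      (Finset.finsuppAntidiag F (r * k)).card := by
  classical
  rw [← Finset.card_biUnion]
  · have hmem : ∀ l, l ∈ (𝒦.biUnion fun G =>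
        (Finset.finsuppAntidiag G k).filter fun l => l.support = G) ↔
        l.support ∈ 𝒦 ∧ l.degree = k := by
      intro l
      simp only [Finset.mem_biUnion, Finset.mem_filter, Finset.mem_finsuppAntidiag]
      constructor
      · rintro ⟨G, h1, ⟨h2, -⟩, rfl⟩
        exact ⟨h1, h2⟩
      · rintro ⟨h1, h2⟩
        exact ⟨_, h1, ⟨h2, subset_rfl⟩, rfl⟩
    refine Finset.card_bij (fun l _ => Finsupp.equivFunOnFinite.symm (weightedSum l)) ?_ ?_ ?_
    · intro l hl
      obtain ⟨h1, h2⟩ := (hmem l).1 hl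
      rw [h𝒦, mem_insert_faces_restrict_iff hr] at h1
      obtain ⟨h1, -, h3⟩ := h1
      have h0 : ∀ i ∉ F, weightedSum l i = 0 := fun i hi => by
        rw [weightedSum_apply]
        exact Finset.sum_eq_zero fun v hv => by rw [h3 v hv i hi, mul_zero]
      rw [Finset.mem_finsuppAntidiag]
      refine ⟨?_, fun i hi => ?_⟩
      · have : ∑ i ∈ F, weightedSum l i = ∑ i, weightedSum l i :=
          Finset.sum_subset (Finset.subset_univ _) fun i _ hi => h0 i hi
        refine this.trans ?_
        simp only [weightedSum_apply]
        rw [Finset.sum_comm, ← h2, Finsupp.degree_apply, Finset.mul_sum]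
        refine Finset.sum_congr rfl fun v hv => ?_
        rw [← Finset.mul_sum, h1 v hv, mul_comm]
      · by_contra h
        exact Finsupp.mem_support_iff.1 hi (h0 i h)
    · intro l hl l' hl' he
      obtain ⟨h1, h2⟩ := (hmem l).1 hl
      obtain ⟨h1', h2'⟩ := (hmem l').1 hl'
      rw [h𝒦, mem_insert_faces_restrict_iff hr] at h1 h1'
      exact weightedSum_injOn k l l' h1.2.1 h1'.2.1 h2 h2' (Finsupp.equivFunOnFinite.symm.injective he)
    · intro u hu
      obtain ⟨h1, h2⟩ := Finset.mem_finsuppAntidiag.1 hu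
      have h0 : ∀ i ∉ F, u i = 0 := fun i hi => by
        by_contra h
        exact hi (h2 (Finsupp.mem_support_iff.2 h))
      have hsum : ∑ i, u i = r * k := by
        rw [← h1]
        exact (Finset.sum_subset (Finset.subset_univ _) fun i _ hi => h0 i hi).symm
      -- Division by `k` needs `k > 0`; for `k = 0` the preimage is the empty multiset on the empty
      -- face.
      rcases Nat.eq_zero_or_pos k with rfl | hk
      · refine ⟨0, (hmem 0).2 ⟨(h𝒦 _).2 (Or.inl rfl), by simp⟩, ?_⟩
        ext i
        have := (Finset.sum_eq_zero_iff.1 hsum) i (Finset.mem_univ i)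
        simp [this]
      · obtain ⟨l, e1, e2, e3, e4, e5⟩ := exists_weightedSum_eq (⇑u) hk hsum
        refine ⟨l, (hmem l).2 ⟨?_, e2⟩, by rw [e1]; ext i; simp⟩
        rw [h𝒦, mem_insert_faces_restrict_iff hr]
        exact ⟨e4, e3, fun v hv i hi => e5 v hv i (h0 i hi)⟩
  · intro G _ G' _ hne
    rw [Function.onFun, Finset.disjoint_left]
    intro l h h'
    exact hne ((Finset.mem_filter.1 h).2.symm.trans (Finset.mem_filter.1 h').2)

theorem finite_insert_faces {r : ℕ} (hr : 1 ≤ r) (F : Finset V) :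
    (insert ∅ ((edgewise (simplex V) r).restrict F).faces).Finite := by
  refine ((Finset.piAntidiag Finset.univ r).powerset : Finset (Finset (V → ℕ))).finite_toSet.subset
    fun G hG => ?_
  rw [mem_insert_faces_restrict_iff hr] at hG
  rw [Finset.mem_coe, Finset.mem_powerset]
  intro u hu
  rw [Finset.mem_piAntidiag]
  exact ⟨hG.1 u hu, by simp⟩

end Vertices

/-! ### Sections of power series -/

section PowerSeriesSection

open PowerSeries in
/-- The power series whose coefficients are those of `f` at multiples of `r`. -/
noncomputable def psSection (r : ℕ) (f : ℝ⟦X⟧) : ℝ⟦X⟧ := PowerSeries.mk fun k => PowerSeries.coeff (r * k) f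

theorem one_sub_X_pow_mul_psSection {r : ℕ} (hr : 1 ≤ r) (m : ℕ) (f : PowerSeries ℝ) :
    (1 - PowerSeries.X) ^ m * psSection r f =
      psSection r ((1 - PowerSeries.X ^ r) ^ m * f) := by
  induction m generalizing f with
  | zero => simp
  | succ m ih =>
    have h1 : (1 - PowerSeries.X) * psSection r f = psSection r ((1 - PowerSeries.X ^ r) * f) := by
      ext k
      rw [sub_mul, sub_mul, one_mul, one_mul, map_sub, psSection, psSection]
      cases k with
      | zero =>
        simp [PowerSeries.coeff_X_pow_mul', Nat.ne_of_gt hr]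
      | succ k =>
        rw [PowerSeries.coeff_succ_X_mul]
        simp [PowerSeries.coeff_X_pow_mul', mul_add]
    rw [pow_succ, mul_assoc, h1, ih, pow_succ, mul_assoc]

theorem psSection_coe {r : ℕ} (hr : 1 ≤ r) (p : ℝ[X]) :
    psSection r (p : PowerSeries ℝ) = (E r p : ℝ[X]) := by
  ext k
  simp [psSection, coeff_E hr]

/-- Write `1 + ⋯ + x^(r-1) = (1 - x^r)/(1 - x)`; factors `1 - x^r` leave the section as `1 - x`. -/
theorem coe_E_geom_pow {r : ℕ} (hr : 1 ≤ r) (m : ℕ) :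
    ((E r ((∑ i ∈ Finset.range r, (X : ℝ[X]) ^ i) ^ m) : ℝ[X]) : PowerSeries ℝ) =
      (1 - PowerSeries.X) ^ m * psSection r (PowerSeries.mk (1 : ℕ → ℝ) ^ m) := by
  rw [one_sub_X_pow_mul_psSection hr, ← mul_pow, ← psSection_coe hr]
  congr 1
  have h1 := geom_sum_mul_neg (X : ℝ[X]) r
  have h2 := congrArg (fun p : ℝ[X] => (p : PowerSeries ℝ)) h1
  simp only [Polynomial.coe_mul, Polynomial.coe_sub, Polynomial.coe_one, Polynomial.coe_X,
    Polynomial.coe_pow] at h2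
  rw [← h2, mul_assoc, mul_comm (1 - PowerSeries.X), PowerSeries.mk_one_mul_one_sub_eq_one, mul_one,
    Polynomial.coe_pow]

theorem coeff_mk_one_pow {ι : Type*} [DecidableEq ι] (F : Finset ι) (N : ℕ) :
    PowerSeries.coeff N (PowerSeries.mk (1 : ℕ → ℝ) ^ F.card) =
      ((Finset.finsuppAntidiag F N).card : ℝ) := by
  rw [← Finset.prod_const, PowerSeries.coeff_prod]
  simp

/-- `(x/(1-x))^|G|` counts positive multiplicities on `G`, that is, multisets with support exactly
`G`. -/
theorem coeff_X_mul_mk_one_pow {ι : Type*} [DecidableEq ι] (G : Finset ι) (k : ℕ) :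
    PowerSeries.coeff k ((PowerSeries.X * PowerSeries.mk (1 : ℕ → ℝ)) ^ G.card) =
      (((Finset.finsuppAntidiag G k).filter fun l => l.support = G).card : ℝ) := by
  have hJ : ∀ n, PowerSeries.coeff n (PowerSeries.X * PowerSeries.mk (1 : ℕ → ℝ)) =
      if n ≠ 0 then 1 else 0 := by
    intro n
    cases n with
    | zero => simp
    | succ n => simp [PowerSeries.coeff_succ_X_mul]
  rw [← Finset.prod_const, PowerSeries.coeff_prod, Finset.card_filter, Nat.cast_sum]
  refine Finset.sum_congr rfl fun l hl => ?_
  simp only [hJ]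
  rw [Finset.prod_ite_zero, Finset.prod_const_one, Nat.cast_ite, Nat.cast_one, Nat.cast_zero]
  refine if_congr ?_ rfl rfl
  have hsub := (Finset.mem_finsuppAntidiag.1 hl).2
  exact ⟨fun h => hsub.antisymm fun i hi => Finsupp.mem_support_iff.2 (h i hi),
    fun h i hi => Finsupp.mem_support_iff.1 (h ▸ hi)⟩

end PowerSeriesSection

/-! ### The `h`-polynomial as a power series -/

section HPolynomial

variable {W : Type*} {K : PreAbstractSimplicialComplex W} {𝒦 : Finset (Finset W)}

theorem fNum_eq_card (h𝒦 : ∀ G, G ∈ 𝒦 ↔ G ∈ insert ∅ K.faces) (i : ℕ) : fNum K i = (𝒦.filter fun G => G.card = i).card := by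
  rw [fNum, ← Set.ncard_coe_finset]
  congr 1
  ext G
  simp [← h𝒦]

theorem bddAbove_card_faces (h𝒦 : ∀ G, G ∈ 𝒦 ↔ G ∈ insert ∅ K.faces) :
    BddAbove (Finset.card '' K.faces) :=
  ((𝒦.finite_toSet.subset fun G hG => (h𝒦 G).2 (Or.inr hG)).image _).bddAbove

theorem card_le_rank (h𝒦 : ∀ G, G ∈ 𝒦 ↔ G ∈ insert ∅ K.faces)
    {G : Finset W} (hG : G ∈ 𝒦) : G.card ≤ rank K := by
  rcases (h𝒦 G).1 hG with rfl | h
  · simp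
  · exact le_csSup (bddAbove_card_faces h𝒦) ⟨G, h, rfl⟩

theorem fNum_rank_pos (h𝒦 : ∀ G, G ∈ 𝒦 ↔ G ∈ insert ∅ K.faces) : 0 < fNum K (rank K) := by
  rw [fNum_eq_card h𝒦, Finset.card_pos]
  rcases K.faces.eq_empty_or_nonempty with h | h
  · refine ⟨∅, Finset.mem_filter.2 ⟨(h𝒦 _).2 (Or.inl rfl), ?_⟩⟩
    simp [rank, h]
  · obtain ⟨G, hG, e⟩ := Nat.sSup_mem (h.image Finset.card) (bddAbove_card_faces h𝒦)
    exact ⟨G, Finset.mem_filter.2 ⟨(h𝒦 _).2 (Or.inr hG), e⟩⟩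

theorem eval_one_hPoly_ne_zero (h𝒦 : ∀ G, G ∈ 𝒦 ↔ G ∈ insert ∅ K.faces) :
    (hPoly K).eval 1 ≠ 0 := by
  rw [hPoly, eval_finsetSum, Finset.sum_eq_single (rank K)]
  · simpa using (fNum_rank_pos h𝒦).ne'
  · intro i hi hne
    rw [Finset.mem_range] at hi
    rw [eval_mul, eval_pow, eval_sub, eval_one, eval_X, sub_self, zero_pow (by omega), mul_zero]
  · simp

theorem coe_hPoly (h𝒦 : ∀ G, G ∈ 𝒦 ↔ G ∈ insert ∅ K.faces) :
    ((hPoly K : ℝ[X]) : PowerSeries ℝ) = (1 - PowerSeries.X) ^ rank K *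
    ∑ G ∈ 𝒦, (PowerSeries.X * PowerSeries.mk (1 : ℕ → ℝ)) ^ G.card := by
  rw [← Finset.sum_fiberwise_of_maps_to (g := Finset.card) (t := Finset.range (rank K + 1))
    (fun G hG => Finset.mem_range.2 (Nat.lt_succ_of_le (card_le_rank h𝒦 hG))), Finset.mul_sum, hPoly,
    ← Polynomial.coeToPowerSeries.ringHom_apply, map_sum]
  refine Finset.sum_congr rfl fun i hi => ?_
  have hi' : i ≤ rank K := Nat.lt_succ_iff.1 (Finset.mem_range.1 hi)
  rw [Finset.sum_congr rfl (g := fun _ => (PowerSeries.X * PowerSeries.mk (1 : ℕ → ℝ)) ^ i)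
    (fun G hG => by rw [(Finset.mem_filter.1 hG).2]), Finset.sum_const, ← fNum_eq_card h𝒦,
    nsmul_eq_mul]
  obtain ⟨m, hm⟩ := Nat.exists_eq_add_of_le hi'
  rw [hm, Nat.add_sub_cancel_left, Polynomial.coeToPowerSeries.ringHom_apply]
  simp only [Polynomial.coe_mul, Polynomial.coe_pow, Polynomial.coe_sub, Polynomial.coe_one,
    Polynomial.coe_X, Polynomial.coe_C]
  rw [map_natCast]
  have h1 : (1 - PowerSeries.X) ^ i * PowerSeries.mk (1 : ℕ → ℝ) ^ i = 1 := by
    rw [← mul_pow, mul_comm, PowerSeries.mk_one_mul_one_sub_eq_one, one_pow]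
  rw [pow_add, mul_pow]
  linear_combination (-(fNum K i : PowerSeries ℝ) * PowerSeries.X ^ i *
    (1 - PowerSeries.X) ^ m) * h1

end HPolynomial

/-! ### The local `h`-polynomial of the edgewise subdivision -/

section LocalHPolynomial

theorem eval_one_E_geom_pow_pos {r : ℕ} (hr : 1 ≤ r) (m : ℕ) :
    0 < (E r ((∑ i ∈ Finset.range r, (X : ℝ[X]) ^ i) ^ m)).eval 1 := by
  have hnn : ∀ k, 0 ≤ ((∑ i ∈ Finset.range r, (X : ℝ[X]) ^ i) ^ m).coeff k := by
    induction m with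
    | zero => intro k; rw [pow_zero, coeff_one]; split_ifs <;> simp
    | succ m ih =>
      intro k
      rw [pow_succ, coeff_mul]
      refine Finset.sum_nonneg fun x _ => mul_nonneg (ih _) ?_
      rw [finsetSum_coeff]
      refine Finset.sum_nonneg fun i _ => ?_
      rw [coeff_X_pow]
      split_ifs <;> simp
  have h0 : ((∑ i ∈ Finset.range r, (X : ℝ[X]) ^ i) ^ m).coeff 0 = 1 := by
    rw [coeff_zero_eq_eval_zero, eval_pow, eval_finsetSum, Finset.sum_eq_single 0]
    · simp
    · intro i _ hi; simp [hi]
    · intro h; exact absurd (Finset.mem_range.2 hr) h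
  rw [eval_eq_sum_range]
  simp only [one_pow, mul_one, coeff_E hr]
  refine Finset.sum_pos' (fun k _ => hnn _) ⟨0, by simp, ?_⟩
  rw [mul_zero, h0]
  exact one_pos

variable {V : Type*} [Fintype V] [LinearOrder V]

theorem hPoly_restrict_edgewise {r : ℕ} (hr : 1 ≤ r) (F : Finset V) :
    hPoly ((edgewise (simplex V) r).restrict F) =
      E r ((∑ i ∈ Finset.range r, (X : ℝ[X]) ^ i) ^ F.card) := by
  have hfin := finite_insert_faces hr F
  set K := (edgewise (simplex V) r).restrict F with hK
  set P := E r ((∑ i ∈ Finset.range r, (X : ℝ[X]) ^ i) ^ F.card) with hP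
  have h𝒦 : ∀ G, G ∈ hfin.toFinset ↔ G ∈ insert ∅ K.faces := fun G => hfin.mem_toFinset
  have hsum : ∑ G ∈ hfin.toFinset, (PowerSeries.X * PowerSeries.mk (1 : ℕ → ℝ)) ^ G.card =
      psSection r (PowerSeries.mk (1 : ℕ → ℝ) ^ F.card) := by
    ext k
    rw [map_sum, psSection, PowerSeries.coeff_mk, coeff_mk_one_pow,
      ← card_weighted_faces hr F _ h𝒦 k, Nat.cast_sum]
    exact Finset.sum_congr rfl fun G _ => coeff_X_mul_mk_one_pow G k
  have h1 := coe_hPoly h𝒦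
  have h2 := coe_E_geom_pow hr F.card
  rw [hsum] at h1
  have hmul : (1 - X : ℝ[X]) ^ F.card * hPoly K = (1 - X) ^ rank K * P := by
    apply Polynomial.coe_injective
    simp only [Polynomial.coe_mul, Polynomial.coe_pow, Polynomial.coe_sub, Polynomial.coe_one,
      Polynomial.coe_X]
    rw [h1, hP, h2]
    ring
  have hX : (1 - X : ℝ[X]) ≠ 0 := by
    intro e
    have := congrArg (eval 0) e
    simp at this
  -- This determines the dimension without exhibiting a facet: if `rank K` and `|F|` differed, a
  -- leftover factor `1 - X` would force `P` or `hPoly K` to vanish at `1`, but neither does.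
  rcases lt_trichotomy (rank K) F.card with h | h | h
  · obtain ⟨m, hm⟩ := Nat.exists_eq_add_of_lt h
    rw [hm, add_assoc, pow_add, mul_assoc] at hmul
    have := congrArg (eval 1) (mul_left_cancel₀ (pow_ne_zero _ hX) hmul)
    rw [eval_mul, eval_pow, eval_sub, eval_one, eval_X, sub_self, zero_pow (by omega),
      zero_mul] at this
    exact absurd this (eval_one_E_geom_pow_pos hr _).ne
  · rw [h] at hmul
    exact mul_left_cancel₀ (pow_ne_zero _ hX) hmul
  · obtain ⟨m, hm⟩ := Nat.exists_eq_add_of_lt h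
    rw [hm, add_assoc, pow_add, mul_assoc] at hmul
    have := congrArg (eval 1) (mul_left_cancel₀ (pow_ne_zero _ hX) hmul)
    rw [eval_mul, eval_pow, eval_sub, eval_one, eval_X, sub_self, zero_pow (by omega),
      zero_mul] at this
    exact absurd this (eval_one_hPoly_ne_zero h𝒦)

theorem localHPoly_edgewise {r : ℕ} (hr : 1 ≤ r) :
    localHPoly (edgewise (simplex V) r) =
      E r ((∑ k ∈ Finset.Icc 1 (r - 1), (X : ℝ[X]) ^ k) ^ Fintype.card V) := by
  have hB : ∑ k ∈ Finset.Icc 1 (r - 1), (X : ℝ[X]) ^ k =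
      ∑ i ∈ Finset.range r, (X : ℝ[X]) ^ i + (-1) := by
    obtain ⟨m, rfl⟩ := Nat.exists_eq_add_of_le' hr
    have hI : Finset.Icc 1 m = Finset.Ico 1 (m + 1) := by ext; simp
    rw [Finset.sum_range_succ', pow_zero, add_neg_cancel_right, Nat.add_sub_cancel, hI,
      Finset.sum_Ico_eq_sum_range]
    simp [add_comm]
  rw [hB, ← Fintype.sum_pow_mul_eq_add_pow, map_sum, localHPoly]
  refine Finset.sum_congr rfl fun F _ => ?_
  have hC : ∀ k : ℕ, (-1 : ℝ[X]) ^ k = C ((-1) ^ k) := by simp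
  rw [hPoly_restrict_edgewise hr, hC, mul_comm _ (C _), ← smul_eq_C_mul, ← smul_eq_C_mul, map_smul]

end LocalHPolynomial

end LocalH

theorem theorem4p3 {V : Type*} [Fintype V] [LinearOrder V] (n r : ℕ)
    (hn : Fintype.card V = n) (hr : 1 ≤ r) :
    LocalH.localHPoly (LocalH.edgewise (LocalH.simplex V) r) =
        LocalH.E r ((∑ k ∈ Finset.Icc 1 (r - 1), (X : ℝ[X]) ^ k) ^ n) ∧
    LocalH.localHPoly (LocalH.edgewise (LocalH.simplex V) r) =
        ∑ w ∈ LocalH.smirnovWords n r, (X : ℝ[X]) ^ LocalH.asc w ∧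
    LocalH.localHPoly (LocalH.edgewise (LocalH.simplex V) r) =
        ∑ i ∈ Finset.range (n / 2 + 1),
          C (LocalH.xi n r i : ℝ) * X ^ i * (1 + X) ^ (n - 2 * i) ∧
    ∀ ξ : ℕ → ℝ, LocalH.IsLocalGamma (LocalH.edgewise (LocalH.simplex V) r) ξ →
      ∀ i ≤ n / 2, ξ i = (LocalH.xi n r i : ℝ) ∧ 0 ≤ ξ i := by
  subst hn
  have h1 := LocalH.localHPoly_edgewise (V := V) hr
  have h2 := h1.trans (LocalH.E_pow_eq_sum_smirnovWords (Fintype.card V) hr)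
  have h3 := h2.trans (LocalH.sum_asc_eq_gamma (Fintype.card V) hr)
  refine ⟨h1, h2, h3, fun ξ hξ i hi => ?_⟩
  have h := LocalH.gamma_coeff_unique (hξ.symm.trans h3) i (Nat.lt_succ_of_le hi)
  exact ⟨h, h ▸ Nat.cast_nonneg _⟩
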